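/- **Setting.** Let $L$ be a lattice of rank $n$, $L_{\mathbb R}=L\otimes\mathbb R$, $L_{\mathbb C}=L\otimes\mathbb C$, $L^*=\mathrm{Hom}(L,\mathbb Z)$. Let $\Delta=(\Sigma,C,w^\pm)$ be an $n$-dimensional simplicial multi-fan in $L$: $\Sigma$ is a finite abstract simplicial complex together with the empty simplex, $\Sigma^{(k)}$ is the set of its simplices with $k$ elements, $\Sigma^{(n)}\neq\emptyset$; $C$ assigns to each $I\in\Sigma$ a rational simplicial cone $C(I)\subset L_{\mathbb R}$ of dimension $|I|$ whose faces are the cones $C(J)$, $J\subset I$ (with $C(J)$ spanned by the rays $C(\{i\})$, $i\in J$); and $w^\pm:\Sigma^{(n)}\to\mathbb Z_{\ge0}$, $w=w^+-w^-$. For $K\in\Sigma$, the projected multi-fan $\Delta_K$ consists of the simplices $J\in\Sigma$ with $J\supset K$, the images $C_K(J)$ of $C(J)$ in the quotient $L^K_{\mathbb R}$ of $L_{\mathbb R}$ by the linear span of $C(K)$, and the same weights. A vector $x\in L^K_{\mathbb R}$ is generic if it lies in the linear span of no cone $C_K(J)$, $K\subset J\in\Sigma$, $|J|<n$. Assume that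 $\Delta$ is complete: for each $K\in\Sigma$ the integer $\sum_{I\in\Sigma^{(n)},\,K\subset I,\,x\in C_K(I)}w(I)$ is the same for all generic $x\in L^K_{\mathbb R}$; this integer is the degree $\deg(\Delta_K)$. Let $\mathcal V=\{v_i\}_{i\in\Sigma^{(1)}}$ be vectors of $L$ such that $v_i$ generates the ray $C(\{i\})$ ($v_i$ need not be primitive). For $I\in\Sigma^{(n)}$ let $\{u_i^I\}_{i\in I}$ be the basis of $L_{\mathbb R}^*$ dual to $\{v_i\}_{i\in I}$ (extended $\mathbb C$-linearly to $L_{\mathbb C}$), and let $H_I$ be the quotient of $L$ by the sublattice generated by $\{v_i\}_{i\in I}$, with a representative $v(h)\in L$ of each $h\in H_I$. For $z,\sigma\in\mathbb C$ and $\operatorname{Im}\tau>0$ put $q=e^{2\pi\sqrt{-1}\tau}$, $\zeta=e^{2\pi\sqrt{-1}\sigma}$, $t^{a}=e^{2\pi\sqrt{-1}az}$ and $$\Phi(z,\tau)=(t^{1/2}-t^{-1/2})\prod_{k\ge1}\frac{(1-tq^k)(1-t^{-1}q^k)}{(1-q^k)^2},\qquad \phi(z,\tau,\sigma)=\frac{\Phi(z+\sigma,\tau)}{\Phi(z,\tau)}.$$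 The equivariant elliptic genus of $(\Delta,\mathcal V)$ is the meromorphic function of $(w,\tau,\sigma)$, $w\in L_{\mathbb C}$, given by $$\varphi(\Delta,\mathcal V)(w,\tau,\sigma)=\sum_{I\in\Sigma^{(n)}}\frac{w(I)}{|H_I|}\sum_{h\in H_I}\prod_{i\in I}\phi\big(\langle u_i^I,-w-v(h)\rangle,\tau,\sigma\big),$$ which does not depend on the choice of the representatives. For $u\in L^*$ write $t^{-u}(w)=e^{-2\pi\sqrt{-1}\langle u,w\rangle}$. **Theorem.** Let $w\in L_{\mathbb C}$ and $\tau,\sigma\in\mathbb C$ be such that $\operatorname{Im}\tau>|\operatorname{Im}\langle u_i^I,w\rangle|>0$ for all $I\in\Sigma^{(n)}$ and $i\in I$, with $\operatorname{Im}\tau>0$, and such that $\zeta q^m\neq1$ for all $m\in\mathbb Z$ (that is, $\sigma$ avoids the polar divisor $\mathbb Z+\mathbb Z\tau$ of the terms below). Then the series below converges absolutely, and $$\varphi(\Delta,\mathcal V)(w,\tau,\sigma)=\left(\sum_{u\in L^*}t^{-u}(w)\sum_{k=0}^n\sum_{J\in\Sigma^{(k)}}(-1)^k\deg(\Delta_J)\prod_{j\in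 J}\frac1{1-\zeta q^{\langle u,v_j\rangle}}\right)\Phi(\sigma,\tau)^n .$$ Thus the two sides are equal as meromorphic functions of $(w,\tau,\sigma)$ on the domain $\operatorname{Im}\tau>|\operatorname{Im}\langle u_i^I,w\rangle|>0$ for all $I\in\Sigma^{(n)}$, $i\in I$. -/

import Mathlib

open scoped TensorProduct

noncomputable section

/-- An `n`-dimensional simplicial multi-fan `Δ = (Σ, C, w⁺, w⁻)` in a lattice `L` of rank
`n = Module.finrank ℤ L`.  The type `ι` is the vertex set `Σ^{(1)}`, and `Σ^{(k)}` consists of the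
members of `Σ` with `k` elements.  The values of `w⁺` and `w⁻` are only ever used on `Σ^{(n)}`. -/
structure MultiFan (ι L : Type*) [AddCommGroup L] where
  /-- The augmented simplicial complex `Σ` (it contains the empty simplex). -/
  simplices : Finset (Finset ι)
  empty_mem : ∅ ∈ simplices
  singleton_mem : ∀ i : ι, {i} ∈ simplices
  down_closed : ∀ I ∈ simplices, ∀ J : Finset ι, J ⊆ I → J ∈ simplices
  top_nonempty : ∃ I ∈ simplices, I.card = Module.finrank ℤ L
  /-- The map `C` to cones in `L_ℝ = ℝ ⊗ L`. -/
  cone : Finset ι → PointedCone ℝ (ℝ ⊗[ℤ] L)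
  /-- For `I ∈ Σ` the cone `C(I)` is a simplicial (hence strongly convex) rational cone of dimension
  `|I|`, and `J ↦ C(J)`, `J ⊆ I`, is the labelling of its faces: `C(I)` is generated by linearly
  independent lattice vectors `g i`, `i ∈ I`, and `C(J)` is its face generated by the `g i` with
  `i ∈ J`. -/
  cone_simplicial : ∀ I ∈ simplices, ∃ g : ι → L,
    LinearIndepOn ℝ (fun i => (1 : ℝ) ⊗ₜ[ℤ] g i) (I : Set ι) ∧
      ∀ J : Finset ι, J ⊆ I →
        cone J = PointedCone.hull ℝ ((fun i => (1 : ℝ) ⊗ₜ[ℤ] g i) '' (J : Set ι))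
  wPlus : Finset ι → ℕ
  wMinus : Finset ι → ℕ

namespace MultiFan

variable {ι L : Type*} [AddCommGroup L]

/-- `w(I) = w⁺(I) - w⁻(I)`. -/
def w (Δ : MultiFan ι L) (I : Finset ι) : ℤ := (Δ.wPlus I : ℤ) - (Δ.wMinus I : ℤ)

/-- `Σ^{(n)}`, where `n` is the rank of `L`. -/
def topSimplices (Δ : MultiFan ι L) : Finset (Finset ι) :=
  Δ.simplices.filter fun I => I.card = Module.finrank ℤ L

/-! ### Projected multi-fans, degrees and completeness

For `K ∈ Σ` the projected multi-fan `Δ_K` lives in the quotient of `L_ℝ` by the linear span of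
`C(K)`; its simplices are the `J ∈ Σ` with `K ⊆ J`, its cones are the images of the `C(J)`, and its
weights are those of `Δ`. For `K = ∅` this is `Δ` itself. -/

/-- The quotient `L^K_ℝ` of `L_ℝ` by the subspace `(L_K)_ℝ` generated by `C(K)`. -/
abbrev ProjSpace (Δ : MultiFan ι L) (K : Finset ι) : Type _ :=
  (ℝ ⊗[ℤ] L) ⧸ Submodule.span ℝ (Δ.cone K : Set (ℝ ⊗[ℤ] L))

/-- `C_K(J)`, the image of `C(J)` in `L^K_ℝ`. -/
def projCone (Δ : MultiFan ι L) (K J : Finset ι) : PointedCone ℝ (Δ.ProjSpace K) :=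
  (Δ.cone J).map (Submodule.mkQ (Submodule.span ℝ (Δ.cone K : Set (ℝ ⊗[ℤ] L))))

/-- `x ∈ L^K_ℝ` is generic for `Δ_K`: it lies on no linear subspace spanned by a cone of `Δ_K` of
dimension less than `n - |K|` (the cone `C_K(J)` has dimension `|J| - |K|`). -/
def IsGeneric (Δ : MultiFan ι L) (K : Finset ι) (x : Δ.ProjSpace K) : Prop :=
  ∀ J ∈ Δ.simplices, K ⊆ J → J.card < Module.finrank ℤ L →
    x ∉ Submodule.span ℝ (Δ.projCone K J : Set (Δ.ProjSpace K))

open Classical in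
/-- The integer `d_x` of `Δ_K`: the sum of `w(I)` over `I ∈ Σ^{(n)}` with `K ⊆ I` and
`x ∈ C_K(I)`. -/
def localDegree (Δ : MultiFan ι L) (K : Finset ι) (x : Δ.ProjSpace K) : ℤ :=
  ∑ I ∈ Δ.topSimplices.filter (fun I => K ⊆ I ∧ x ∈ Δ.projCone K I), Δ.w I

/-- The projected multi-fan `Δ_K` is pre-complete. -/
def IsPreComplete (Δ : MultiFan ι L) (K : Finset ι) : Prop :=
  ∃ d : ℤ, ∀ x : Δ.ProjSpace K, Δ.IsGeneric K x → Δ.localDegree K x = d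

/-- `Δ` is complete: all its projected multi-fans (including `Δ = Δ_∅`) are pre-complete. -/
def IsComplete (Δ : MultiFan ι L) : Prop :=
  ∀ K ∈ Δ.simplices, Δ.IsPreComplete K

open Classical in
/-- The degree `deg(Δ_K)` of a pre-complete `Δ_K`: the common value of `d_x` for generic `x`
(with the value `0` if `Δ_K` is not pre-complete). -/
def degree (Δ : MultiFan ι L) (K : Finset ι) : ℤ :=
  if h : Δ.IsPreComplete K then h.choose else 0

/-- A set `𝒱 = {v_i}` of vectors of `L` such that `v_i` generates the ray `C(i)`, for every vertex
`i` (the `v_i` need not be primitive). -/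
structure GeneratingVectors (Δ : MultiFan ι L) where
  vec : ι → L
  hull_vec : ∀ i, PointedCone.hull ℝ {(1 : ℝ) ⊗ₜ[ℤ] vec i} = Δ.cone {i}

namespace GeneratingVectors

variable {Δ : MultiFan ι L} (V : Δ.GeneratingVectors)

theorem linearIndepOn (I : Finset ι) (hI : I ∈ Δ.simplices) :
    LinearIndepOn ℝ (fun i => (1 : ℝ) ⊗ₜ[ℤ] V.vec i) (I : Set ι) := by
  obtain ⟨g, hg, hc⟩ := Δ.cone_simplicial I hI
  have key : ∀ i : (I : Set ι), ∃ c : ℝ, c • ((1 : ℝ) ⊗ₜ[ℤ] V.vec i) = (1 : ℝ) ⊗ₜ[ℤ] g i := by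
    intro i
    have h1 := V.hull_vec i
    rw [hc {i.1} (by simp)] at h1
    have h2 : (1 : ℝ) ⊗ₜ[ℤ] g i ∈ PointedCone.hull ℝ {(1 : ℝ) ⊗ₜ[ℤ] V.vec i} := by
      rw [h1]
      exact Submodule.subset_span (by simp)
    obtain ⟨c, hc'⟩ := Submodule.mem_span_singleton.1 h2
    exact ⟨c.1, hc'⟩
  have key2 : ∀ i : (I : Set ι), ∃ c : ℝ, c • ((1 : ℝ) ⊗ₜ[ℤ] g i) = (1 : ℝ) ⊗ₜ[ℤ] V.vec i := by
    intro i
    have h1 := V.hull_vec i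
    rw [hc {i.1} (by simp)] at h1
    have h2 : (1 : ℝ) ⊗ₜ[ℤ] V.vec i ∈
        PointedCone.hull ℝ ((fun i => (1 : ℝ) ⊗ₜ[ℤ] g i) '' (({i.1} : Finset ι) : Set ι)) := by
      rw [← h1]
      exact Submodule.subset_span (by simp)
    rw [Finset.coe_singleton, Set.image_singleton] at h2
    obtain ⟨c, hc'⟩ := Submodule.mem_span_singleton.1 h2
    exact ⟨c.1, hc'⟩
  choose a ha using key
  choose b hb using key2
  have hab : ∀ i, b i ≠ 0 := by
    intro i h0
    have hz : (1 : ℝ) ⊗ₜ[ℤ] V.vec i = 0 := by rw [← hb i, h0, zero_smul]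
    have := ha i
    rw [hz, smul_zero] at this
    exact LinearIndependent.ne_zero i hg this.symm
  have := LinearIndependent.units_smul hg (fun i => Units.mk0 (b i) (hab i))
  have e : ((fun i => Units.mk0 (b i) (hab i)) • fun i : (I : Set ι) => (1 : ℝ) ⊗ₜ[ℤ] g i) =
      fun i : (I : Set ι) => (1 : ℝ) ⊗ₜ[ℤ] V.vec i := funext hb
  rw [e] at this
  exact this

/-- The sublattice `L_{I,𝒱}` of `L` generated by the `v_i`, `i ∈ I`. -/
def sublattice (I : Finset ι) : Submodule ℤ L :=
  Submodule.span ℤ (V.vec '' (I : Set ι))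

/-- The group `H_I = L / L_{I,𝒱}`. -/
abbrev H (I : Finset ι) : Type _ := L ⧸ V.sublattice I

variable [Module.Free ℤ L] [Module.Finite ℤ L]

theorem finite_H (I : Δ.topSimplices) : Finite (V.H I) := by
  obtain ⟨hI, hcard⟩ := Finset.mem_filter.1 I.2
  have h1 : LinearIndependent ℤ (fun i : I.1 => V.vec i) := by
    have h2 : LinearIndependent ℝ (fun i : I.1 => (1 : ℝ) ⊗ₜ[ℤ] V.vec i) := V.linearIndepOn I hI
    have h3 : LinearIndependent ℤ (fun i : I.1 => (1 : ℝ) ⊗ₜ[ℤ] V.vec i) :=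
      h2.restrict_scalars' ℤ
    exact LinearIndependent.of_comp (TensorProduct.mk ℤ ℝ L 1) h3
  apply Submodule.finiteQuotientOfFreeOfRankEq
  have h4 := finrank_span_eq_card h1
  have h5 : Set.range (fun i : I.1 => V.vec i) = V.vec '' (I.1 : Set ι) := by
    ext x; simp
  rw [h5, Fintype.card_coe, hcard] at h4
  exact h4

instance (I : Δ.topSimplices) : Fintype (V.H I) :=
  haveI := V.finite_H I
  Fintype.ofFinite _

/-- For `I ∈ Σ^{(n)}`, the basis `{v_i}_{i ∈ I}` of `L_ℝ`. -/
def basis (I : Δ.topSimplices) : Module.Basis I.1 ℝ (ℝ ⊗[ℤ] L) := by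
  classical
  exact Module.Basis.mk (v := fun i : I.1 => (1 : ℝ) ⊗ₜ[ℤ] V.vec i)
    (V.linearIndepOn I (Finset.mem_filter.1 I.2).1)
    (by
      have h := LinearIndependent.span_eq_top_of_card_eq_finrank'
        (V.linearIndepOn I (Finset.mem_filter.1 I.2).1)
        (by
          rw [Module.finrank_baseChange]
          simpa using (Finset.mem_filter.1 I.2).2)
      exact h.ge)

/-- The dual basis vector `u_i^I ∈ L_ℝ^*`. -/
def dualVec (I : Δ.topSimplices) (i : I.1) : Module.Dual ℝ (ℝ ⊗[ℤ] L) :=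
  (V.basis I).coord i

end GeneratingVectors
end MultiFan

/-- The `ℂ`-linear extension to `L_ℂ = ℂ ⊗ L` of an element `u` of `L_ℝ^*`; `pairing u w` is
`⟨u, w⟩`. -/
def pairing {L : Type*} [AddCommGroup L] (u : Module.Dual ℝ (ℝ ⊗[ℤ] L)) : (ℂ ⊗[ℤ] L) →ₗ[ℂ] ℂ :=
  LinearMap.liftBaseChange ℂ
    ((Complex.ofRealAm.toLinearMap.restrictScalars ℤ ∘ₗ u.restrictScalars ℤ) ∘ₗ
      TensorProduct.mk ℤ ℝ L 1)

/-- The pairing `⟨u, w⟩` of `u ∈ L^*` with `w ∈ L_ℂ = ℂ ⊗ L`. -/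
def latticePairing {L : Type*} [AddCommGroup L] (u : Module.Dual ℤ L) : (ℂ ⊗[ℤ] L) →ₗ[ℂ] ℂ :=
  LinearMap.liftBaseChange ℂ (Algebra.linearMap ℤ ℂ ∘ₗ u)

/-- `e(x) = exp(2πix)`; thus `t = e(z)`, `q = e(τ)`, `ζ = e(σ)`. -/
def expTwoPiI (x : ℂ) : ℂ := Complex.exp (2 * Real.pi * Complex.I * x)

/-- `Φ(z, τ) = (t^{1/2} - t^{-1/2}) ∏_{k ≥ 1} (1 - t q^k)(1 - t⁻¹ q^k) / (1 - q^k)²`, where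
`t^{1/2} = exp(πiz)`. -/
def jacobiPhi (z τ : ℂ) : ℂ :=
  (expTwoPiI (z / 2) - expTwoPiI (-z / 2)) *
    ∏' k : ℕ, ((1 - expTwoPiI z * expTwoPiI τ ^ (k + 1)) *
      (1 - (expTwoPiI z)⁻¹ * expTwoPiI τ ^ (k + 1)) / (1 - expTwoPiI τ ^ (k + 1)) ^ 2)

/-- `φ(z, τ, σ) = Φ(z + σ, τ) / Φ(z, τ)`. -/
def ellipticPhi (z τ σ : ℂ) : ℂ := jacobiPhi (z + σ) τ / jacobiPhi z τ

namespace MultiFan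

variable {ι L : Type*} [AddCommGroup L] [Module.Free ℤ L] [Module.Finite ℤ L]

/-- The equivariant elliptic genus `φ(Δ, 𝒱)` as a meromorphic function of
`(w, τ, σ) ∈ L_ℂ × ℍ × ℂ`.  The representative `v(h) ∈ L` of `h ∈ H_I` is `h.out`; the summands
do not depend on its choice. -/
def ellipticGenus (Δ : MultiFan ι L) (V : Δ.GeneratingVectors) (w : ℂ ⊗[ℤ] L) (τ σ : ℂ) : ℂ :=
  ∑ I : Δ.topSimplices, ((Δ.w I : ℂ) / (Fintype.card (V.H I) : ℂ)) *
    ∑ h : V.H I, ∏ i : I.1,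
      ellipticPhi (pairing (V.dualVec I i) (-w - (1 : ℂ) ⊗ₜ[ℤ] h.out)) τ σ

/-- The coefficient
`∑_{k=0}^n ∑_{J ∈ Σ^{(k)}} (-1)^k deg(Δ_J) ∏_{j ∈ J} 1 / (1 - ζ q^{⟨u, v_j⟩})`, `u ∈ L^*`. -/
def characterCoeff (Δ : MultiFan ι L) (V : Δ.GeneratingVectors) (u : Module.Dual ℤ L)
    (τ σ : ℂ) : ℂ :=
  ∑ k ∈ Finset.range (Module.finrank ℤ L + 1), ∑ J ∈ Δ.simplices.filter (fun J => J.card = k),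
    (-1) ^ k * (Δ.degree J : ℂ) *
      ∏ j ∈ J, 1 / (1 - expTwoPiI σ * expTwoPiI τ ^ (u (V.vec j)))

end MultiFan

end

/-! Kronecker's formula turns each factor of the genus into a series in powers of `e(z)`. On `0 <
|Im z| < Im τ`, `φ(z, τ, σ) = Φ(σ, τ) ∑_m e(z)^m (ε - 1 / (1 - ζ q^m))`, with `ε = 1` if `Im z < 0`
and `ε = 0` if `Im z > 0` (`ellipticPhi_expansion`). The positive half follows from the Jacobi
triple product. The negative half follows from it because `Φ` is odd.

For a top simplex `I`, put `z_i = ⟨u_i^I, -w - v(h)⟩` and multiply out over `i ∈ I`, which gives a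
series over `m ∈ ℤ^I`. The representative `v(h)` enters only through a character of `H_I`. Averaging
over `h` therefore keeps exactly those `m` for which `∑ m_i u_i^I` is integral on `L`, that is, `m_i
= ⟨u, v_i⟩` with `u ∈ L^*` (`sum_prod_ellipticPhi`). The monomial is then `t^{-u}(w)`, independently
of `I`, so the contributions of all `I` can be added coefficientwise.

It remains to identify `∑_I w(I) ∏_{i ∈ I} (ε_i - b_i)`, where `b_i = 1 / (1 - ζ q^{⟨u, v_i⟩})` and
`ε_i = 1` exactly when `⟨u_i^I, Im w⟩ > 0`. Expanding over `J ⊆ I`, the coefficient of `(-1)^{|J|}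
∏_{j ∈ J} b_j` counts, with weight, the `I ⊇ J` such that `⟨u_i^I, Im w⟩ > 0` for all `i ∈ I`
outside `J`. This says that the image of `Im w` lies in `C_J(I)`, so by completeness the count is
`deg(Δ_J)` (`degree_eq_sum`, `characterCoeff_eq_sum`). The same real vector `Im w` thus selects the
region of expansion and computes the degrees. -/

noncomputable section

open Filter Topology

/-! ### The theta series -/

/-- The exponent `n (n - 1) / 2`. -/
def triangle (n : ℤ) : ℤ := n * (n - 1) / 2

theorem two_mul_triangle (n : ℤ) : 2 * triangle n = n * (n - 1) :=
  Int.mul_ediv_cancel' (Int.even_mul_pred_self n).two_dvd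

theorem triangle_add (m n : ℤ) : triangle (m + n) = triangle m + triangle n + m * n := by
  have h1 := two_mul_triangle (m + n)
  have h2 := two_mul_triangle m
  have h3 := two_mul_triangle n
  have : 2 * triangle (m + n) = 2 * (triangle m + triangle n + m * n) := by
    rw [mul_add, mul_add, h1, h2, h3]; ring
  omega

/-- The coefficient `(-1)^n q^{n(n-1)/2}` of the theta series. -/
def thetaCoeff (q : ℂ) (n : ℤ) : ℂ := (-1) ^ n * q ^ triangle n

@[simp] theorem thetaCoeff_zero (q : ℂ) : thetaCoeff q 0 = 1 := by simp [thetaCoeff, triangle]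

theorem thetaCoeff_ne_zero {q : ℂ} (hq : q ≠ 0) (n : ℤ) : thetaCoeff q n ≠ 0 :=
  mul_ne_zero (zpow_ne_zero _ (by norm_num)) (zpow_ne_zero _ hq)

theorem thetaCoeff_add {q : ℂ} (hq : q ≠ 0) (m n : ℤ) :
    thetaCoeff q (m + n) = thetaCoeff q m * thetaCoeff q n * q ^ (m * n) := by
  rw [thetaCoeff, thetaCoeff, thetaCoeff, triangle_add, zpow_add₀ (by norm_num), zpow_add₀ hq,
    zpow_add₀ hq]
  ring

@[simp] theorem thetaCoeff_one (q : ℂ) : thetaCoeff q 1 = -1 := by simp [thetaCoeff, triangle]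

theorem thetaCoeff_neg {q : ℂ} (hq : q ≠ 0) (n : ℤ) :
    thetaCoeff q (-n) = thetaCoeff q n * q ^ n := by
  have h : triangle (-n) = triangle n + n := by
    have h1 := two_mul_triangle (-n)
    have h2 := two_mul_triangle n
    have : 2 * triangle (-n) = 2 * (triangle n + n) := by rw [mul_add, h1, h2]; ring
    omega
  rw [thetaCoeff, thetaCoeff, h, zpow_add₀ hq, zpow_neg, ← inv_zpow]
  norm_num
  ring

/-- The theta series `∑ (-1)^n q^{n(n-1)/2} t^n`. -/
def thetaSeries (q t : ℂ) : ℂ := ∑' n : ℤ, thetaCoeff q n * t ^ n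

theorem summable_thetaCoeff_nat {q t : ℂ} (hq : q ≠ 0) (hq1 : ‖q‖ < 1) (ht : t ≠ 0) :
    Summable fun n : ℕ => thetaCoeff q n * t ^ n := by
  refine summable_of_ratio_test_tendsto_lt_one zero_lt_one
    (Eventually.of_forall fun n => mul_ne_zero (thetaCoeff_ne_zero hq _) (pow_ne_zero _ ht)) ?_
  have h : ∀ n : ℕ, ‖thetaCoeff q ((n + 1 : ℕ) : ℤ) * t ^ (n + 1)‖ / ‖thetaCoeff q n * t ^ n‖ =
      ‖q‖ ^ n * ‖t‖ := by
    intro n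
    have h1 : ‖thetaCoeff q n * t ^ n‖ ≠ 0 :=
      norm_ne_zero_iff.2 (mul_ne_zero (thetaCoeff_ne_zero hq _) (pow_ne_zero _ ht))
    rw [div_eq_iff h1, Nat.cast_succ, thetaCoeff_add hq, thetaCoeff_one, pow_succ]
    simp only [norm_mul, norm_neg, norm_one, norm_pow, mul_one, zpow_natCast]
    ring
  simp_rw [h]
  simpa using (tendsto_pow_atTop_nhds_zero_of_lt_one (norm_nonneg q) hq1).mul_const ‖t‖

theorem summable_thetaSeries {q t : ℂ} (hq : q ≠ 0) (hq1 : ‖q‖ < 1) (ht : t ≠ 0) :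
    Summable fun n : ℤ => thetaCoeff q n * t ^ n := by
  refine Summable.of_nat_of_neg (by simpa using summable_thetaCoeff_nat hq hq1 ht) ?_
  -- The terms of negative index at `t` are those of positive index at `q / t`.
  refine (summable_thetaCoeff_nat (t := q * t⁻¹) hq hq1 (mul_ne_zero hq (inv_ne_zero ht))).congr
    fun n => ?_
  rw [thetaCoeff_neg hq, mul_pow, zpow_neg, inv_pow]
  simp only [zpow_natCast]
  ring

theorem summable_norm_thetaSeries {q t : ℂ} (hq : q ≠ 0) (hq1 : ‖q‖ < 1) (ht : t ≠ 0) :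
    Summable fun n : ℤ => ‖thetaCoeff q n * t ^ n‖ :=
  (summable_thetaSeries hq hq1 ht).norm

/-- The theta series vanishes at the integral powers of `q`. -/
theorem thetaSeries_zpow {q : ℂ} (hq : q ≠ 0) (k : ℤ) : thetaSeries q (q ^ k) = 0 := by
  -- The involution `n ↦ 1 - 2k - n` preserves the exponent of `q` and reverses the sign of each
  -- term.
  have h : thetaSeries q (q ^ k) = -thetaSeries q (q ^ k) := by
    conv_lhs => rw [thetaSeries, ← (Equiv.subLeft (1 - 2 * k)).tsum_eq]
    rw [thetaSeries, ← tsum_neg]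
    refine tsum_congr fun n => ?_
    have h1 : triangle (1 - 2 * k - n) + k * (1 - 2 * k - n) = triangle n + k * n := by
      have h1 := two_mul_triangle (1 - 2 * k - n)
      have h2 := two_mul_triangle n
      have : 2 * (triangle (1 - 2 * k - n) + k * (1 - 2 * k - n)) = 2 * (triangle n + k * n) := by
        rw [mul_add, mul_add, h1, h2]; ring
      omega
    have h2 : ((-1 : ℂ)) ^ (1 - 2 * k - n) = -(-1) ^ n := by
      rw [zpow_sub₀ (by norm_num), zpow_sub₀ (by norm_num), zpow_mul]
      norm_num
      rw [div_eq_mul_inv, ← inv_zpow, inv_neg_one, neg_one_mul]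
    simp only [Equiv.subLeft_apply, thetaCoeff, mul_assoc, ← zpow_mul, ← zpow_add₀ hq, h1, h2]
    ring
  exact self_eq_neg.1 h

/-! ### The Jacobi triple product -/

/-- `(q; q)_n = ∏_{k=1}^n (1 - q^k)`. -/
def qFactorial (q : ℂ) (n : ℕ) : ℂ := ∏ k ∈ Finset.range n, (1 - q ^ (k + 1))

theorem qFactorial_succ (q : ℂ) (n : ℕ) :
    qFactorial q (n + 1) = qFactorial q n * (1 - q ^ (n + 1)) :=
  Finset.prod_range_succ _ _

@[simp] theorem qFactorial_zero (q : ℂ) : qFactorial q 0 = 1 := Finset.prod_range_zero _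

theorem one_sub_norm_le {q : ℂ} (hq1 : ‖q‖ < 1) (k : ℕ) : 1 - ‖q‖ ≤ ‖1 - q ^ (k + 1)‖ := by
  have h1 : ‖q ^ (k + 1)‖ ≤ ‖q‖ := by
    rw [norm_pow]
    exact pow_le_of_le_one (norm_nonneg _) hq1.le (Nat.succ_ne_zero _)
  have h2 := norm_sub_norm_le (1 : ℂ) (q ^ (k + 1))
  rw [norm_one] at h2
  linarith

theorem one_sub_pow_ne_zero {q : ℂ} (hq1 : ‖q‖ < 1) (k : ℕ) : 1 - q ^ (k + 1) ≠ 0 :=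
  norm_pos_iff.1 ((sub_pos.2 hq1).trans_le (one_sub_norm_le hq1 k))

theorem qFactorial_ne_zero {q : ℂ} (hq1 : ‖q‖ < 1) (n : ℕ) : qFactorial q n ≠ 0 :=
  Finset.prod_ne_zero_iff.2 fun k _ => one_sub_pow_ne_zero hq1 k

theorem exists_tendsto_qFactorial {q : ℂ} (hq1 : ‖q‖ < 1) :
    ∃ c : ℂ, c ≠ 0 ∧ Tendsto (qFactorial q) atTop (𝓝 c) := by
  have hs : Summable fun k : ℕ => ‖-q ^ (k + 1)‖ := by
    simpa using (summable_nat_add_iff 1).2 (summable_geometric_of_lt_one (norm_nonneg q) hq1)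
  refine ⟨∏' k : ℕ, (1 + -q ^ (k + 1)), tprod_one_add_ne_zero_of_summable (fun k => ?_) hs, ?_⟩
  · rw [← sub_eq_add_neg]
    exact one_sub_pow_ne_zero hq1 k
  · have := (multipliable_one_add_of_summable hs).tendsto_prod_tprod_nat
    simp only [← sub_eq_add_neg] at this ⊢
    exact this

/-- Gaussian binomial coefficients. -/
def gaussBinom (q : ℂ) : ℕ → ℕ → ℂ
  | _, 0 => 1
  | 0, _ + 1 => 0
  | m + 1, j + 1 => q ^ (j + 1) * gaussBinom q m (j + 1) + gaussBinom q m j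

theorem gaussBinom_zero_right (q : ℂ) (m : ℕ) : gaussBinom q m 0 = 1 := by
  cases m <;> rfl

theorem gaussBinom_of_lt (q : ℂ) : ∀ {m j : ℕ}, m < j → gaussBinom q m j = 0
  | 0, _ + 1, _ => rfl
  | m + 1, j + 1, h => by
    rw [gaussBinom, gaussBinom_of_lt q (show m < j + 1 by omega),
      gaussBinom_of_lt q (show m < j by omega)]
    simp

/-- The quotient formula in cleared form, which needs no condition on `q`. The induction rests on
`q^{j+1} (1 - q^{i+1}) + (1 - q^{j+1}) = 1 - q^{i+j+2}`. -/
theorem gaussBinom_mul_qFactorial (q : ℂ) : ∀ i j : ℕ,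
    gaussBinom q (i + j) j * (qFactorial q j * qFactorial q i) = qFactorial q (i + j)
  | i, 0 => by simp [gaussBinom_zero_right]
  | 0, j + 1 => by
    have ih := gaussBinom_mul_qFactorial q 0 j
    rw [Nat.zero_add] at ih ⊢
    rw [gaussBinom, gaussBinom_of_lt q (Nat.lt_succ_self j), mul_zero, zero_add, qFactorial_succ]
    linear_combination (1 - q ^ (j + 1)) * ih
  | i + 1, j + 1 => by
    have h1 := gaussBinom_mul_qFactorial q i (j + 1)
    have h2 := gaussBinom_mul_qFactorial q (i + 1) j
    rw [show i + 1 + j = i + (j + 1) by ring] at h2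
    rw [show i + 1 + (j + 1) = i + (j + 1) + 1 by ring, gaussBinom, qFactorial_succ q (i + (j + 1)),
      add_mul]
    calc _ = q ^ (j + 1) * (1 - q ^ (i + 1)) *
            (gaussBinom q (i + (j + 1)) (j + 1) * (qFactorial q (j + 1) * qFactorial q i)) +
          (1 - q ^ (j + 1)) *
            (gaussBinom q (i + (j + 1)) j * (qFactorial q j * qFactorial q (i + 1))) := by
          rw [qFactorial_succ q i, qFactorial_succ q j]; ring
      _ = _ := by rw [h1, h2]; ring

/-- The `q`-binomial theorem. -/
theorem prod_one_sub_mul_pow {q : ℂ} (hq : q ≠ 0) (m : ℕ) : ∀ x : ℂ,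
    ∏ k ∈ Finset.range m, (1 - x * q ^ k) =
      ∑ j ∈ Finset.range (m + 1), thetaCoeff q j * gaussBinom q m j * x ^ j := by
  induction m with
  | zero => intro x; simp [gaussBinom_zero_right]
  | succ m ih =>
    intro x
    have h1 : ∀ k : ℕ, 1 - x * q ^ (k + 1) = 1 - x * q * q ^ k := fun k => by ring
    -- Splitting off the factor `k = 0` leaves the product of length `m` at `x q`.
    rw [Finset.prod_range_succ', Finset.prod_congr rfl fun k _ => h1 k, ih, pow_zero, mul_one,
      Finset.sum_range_succ' _ (m + 1)]
    have h2 : ∀ j : ℕ, thetaCoeff q ((j + 1 : ℕ) : ℤ) * gaussBinom q (m + 1) (j + 1) * x ^ (j + 1) =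
        thetaCoeff q ((j + 1 : ℕ) : ℤ) * gaussBinom q m (j + 1) * (x * q) ^ (j + 1) -
          x * (thetaCoeff q j * gaussBinom q m j * (x * q) ^ j) := by
      intro j
      have h3 : thetaCoeff q ((j + 1 : ℕ) : ℤ) = - (thetaCoeff q j * q ^ j) := by
        rw [Nat.cast_succ, thetaCoeff_add hq, thetaCoeff_one, mul_one, zpow_natCast]; ring
      rw [gaussBinom, h3]
      ring
    rw [Finset.sum_congr rfl fun j _ => h2 j, Finset.sum_sub_distrib, ← Finset.mul_sum,
      Finset.sum_range_succ' _ m]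
    rw [Finset.sum_range_succ (fun j : ℕ => thetaCoeff q ((j + 1 : ℕ) : ℤ) *
      gaussBinom q m (j + 1) * (x * q) ^ (j + 1)) m, gaussBinom_of_lt q (Nat.lt_succ_self m)]
    simp [gaussBinom_zero_right]
    ring

/-- The coefficient of `(-1)^n q^{n(n-1)/2} t^n` in the finite triple product. -/
def finiteTripleCoeff (q : ℂ) (N : ℕ) (n : ℤ) : ℂ :=
  -- Only the lower bound needs a test, because `toNat` truncates there. For `n > N` the Gaussian
  -- binomial is already zero.
  if -N ≤ n then gaussBinom q (2 * N) (n + N).toNat else 0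

/-- The finite form of the triple product identity. -/
theorem finite_triple_product {q t : ℂ} (hq : q ≠ 0) (ht : t ≠ 0) (N : ℕ) :
    (∏ k ∈ Finset.range N, (1 - t * q ^ k)) * ∏ k ∈ Finset.range N, (1 - t⁻¹ * q ^ (k + 1)) =
      ∑' n : ℤ, finiteTripleCoeff q N n * (thetaCoeff q n * t ^ n) := by
  have hinj : Function.Injective fun j : ℕ => (j : ℤ) - N := fun a b h => by simpa using h
  rw [← hinj.tsum_eq]
  swap
  · intro n hn
    by_cases h : -(N : ℤ) ≤ n
    · exact ⟨(n + N).toNat, by simp only; omega⟩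
    · simp [finiteTripleCoeff, h] at hn
  -- Shifting the index by `N` gives a monomial times the `q`-binomial sum of length `2N` at `x = t
  -- q^{-N}`.
  have hterm : ∀ j : ℕ, finiteTripleCoeff q N ((j : ℤ) - N) *
      (thetaCoeff q ((j : ℤ) - N) * t ^ ((j : ℤ) - N)) =
      (thetaCoeff q (-N) * t ^ (-(N : ℤ))) *
        (thetaCoeff q j * gaussBinom q (2 * N) j * (t * q ^ (-(N : ℤ))) ^ j) := by
    intro j
    rw [finiteTripleCoeff, if_pos (by omega), sub_add_cancel, Int.toNat_natCast, sub_eq_add_neg,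
      thetaCoeff_add hq, zpow_add₀ ht, mul_pow, mul_comm (j : ℤ), zpow_mul]
    simp only [zpow_natCast]
    ring
  simp_rw [hterm]
  rw [tsum_mul_left, tsum_eq_sum (s := Finset.range (2 * N + 1)), ← prod_one_sub_mul_pow hq]
  swap
  · intro j hj
    rw [gaussBinom_of_lt q (by simpa using hj)]
    simp
  rw [two_mul, Finset.prod_range_add]
  have h1 : ∀ k : ℕ, 1 - t * q ^ (-(N : ℤ)) * q ^ (N + k) = 1 - t * q ^ k := by
    intro k
    rw [pow_add, zpow_neg, zpow_natCast]
    field_simp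
  rw [Finset.prod_congr rfl fun k _ => h1 k, mul_comm (∏ k ∈ Finset.range N, (1 - t * q ^ k)),
    ← mul_assoc]
  congr 1
  clear h1 hterm hinj
  rw [← Finset.prod_range_reflect (fun k => 1 - t * q ^ (-(N : ℤ)) * q ^ k)]
  -- The monomial is what turns the first `N` factors, read backwards, into the required ones: `1 -
  -- t q^{-(k+1)} = -t q^{-(k+1)} (1 - t⁻¹ q^{k+1})`.
  have h2 : thetaCoeff q (-N) * t ^ (-(N : ℤ)) =
      ∏ k ∈ Finset.range N, (-(t⁻¹ * q ^ (k + 1))) := by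
    induction N with
    | zero => simp
    | succ N ih =>
      rw [Finset.prod_range_succ, ← ih, thetaCoeff_neg hq, thetaCoeff_neg hq, Nat.cast_succ,
        thetaCoeff_add hq, thetaCoeff_one, neg_add, zpow_add₀ ht, mul_one, zpow_natCast,
        zpow_neg_one, zpow_add₀ hq, zpow_one, zpow_natCast]
      ring
  rw [h2, ← Finset.prod_mul_distrib]
  refine Finset.prod_congr rfl fun k hk => ?_
  have hk' := Finset.mem_range.1 hk
  have h3 : q ^ (-(N : ℤ)) * q ^ (N - 1 - k) = (q ^ (k + 1))⁻¹ := by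
    rw [← zpow_natCast, ← zpow_add₀ hq, ← zpow_natCast, ← zpow_neg]
    congr 1
    omega
  rw [mul_assoc t, h3]
  have := pow_ne_zero (k + 1) hq
  field_simp
  ring

/-- For large `N` the coefficient is `(q)_{2N} / ((q)_{N+n} (q)_{N-n})`, and all three factors tend
to `c`. -/
theorem tendsto_finiteTripleCoeff {q c : ℂ} (hq1 : ‖q‖ < 1) (hc : c ≠ 0)
    (h : Tendsto (qFactorial q) atTop (𝓝 c)) (n : ℤ) :
    Tendsto (fun N => finiteTripleCoeff q N n) atTop (𝓝 c⁻¹) := by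
  have h1 : ∀ᶠ N : ℕ in atTop, qFactorial q (2 * N) /
      (qFactorial q (n + N).toNat * qFactorial q (N - n).toNat) = finiteTripleCoeff q N n := by
    filter_upwards [eventually_ge_atTop n.natAbs] with N hN
    rw [finiteTripleCoeff, if_pos (by omega),
      div_eq_iff (mul_ne_zero (qFactorial_ne_zero hq1 _) (qFactorial_ne_zero hq1 _))]
    have := gaussBinom_mul_qFactorial q (N - n).toNat (n + N).toNat
    rw [show (N - n).toNat + (n + N).toNat = 2 * N by omega] at this
    exact this.symm
  refine Tendsto.congr' h1 ?_
  have e : c⁻¹ = c / (c * c) := by field_simp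
  rw [e]
  refine Tendsto.div (h.comp (tendsto_id.const_mul_atTop' two_pos)) (Tendsto.mul (h.comp ?_) (h.comp ?_))
    (mul_ne_zero hc hc)
  · exact tendsto_atTop.2 fun b => by
      filter_upwards [eventually_ge_atTop (b + n.natAbs)] with N hN
      omega
  · exact tendsto_atTop.2 fun b => by
      filter_upwards [eventually_ge_atTop (b + n.natAbs)] with N hN
      omega

/-- Uniformity in both `N` and `n` is what dominated convergence needs. It holds because `(q)_n` and
its inverse are both convergent, hence bounded. -/
theorem exists_norm_finiteTripleCoeff_le {q c : ℂ} (hq1 : ‖q‖ < 1) (hc : c ≠ 0)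
    (h : Tendsto (qFactorial q) atTop (𝓝 c)) :
    ∃ K : ℝ, ∀ N n, ‖finiteTripleCoeff q N n‖ ≤ K := by
  obtain ⟨A, hA⟩ := (Metric.isBounded_range_of_tendsto _ h).exists_norm_le
  obtain ⟨B, hB⟩ := (Metric.isBounded_range_of_tendsto _ (h.inv₀ hc)).exists_norm_le
  have hA' : ∀ n, ‖qFactorial q n‖ ≤ A := fun n => hA _ ⟨n, rfl⟩
  have hB' : ∀ n, ‖(qFactorial q n)⁻¹‖ ≤ B := fun n => hB _ ⟨n, rfl⟩
  have hA0 : 0 ≤ A := (norm_nonneg _).trans (hA' 0)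
  have hB0 : 0 ≤ B := (norm_nonneg _).trans (hB' 0)
  refine ⟨A * (B * B), fun N n => ?_⟩
  rw [finiteTripleCoeff]
  split_ifs with h1
  · by_cases h2 : n ≤ N
    · have := gaussBinom_mul_qFactorial q (N - n).toNat (n + N).toNat
      rw [show (N - n).toNat + (n + N).toNat = 2 * N by omega,
        ← eq_div_iff (mul_ne_zero (qFactorial_ne_zero hq1 _) (qFactorial_ne_zero hq1 _)),
        div_eq_mul_inv, mul_inv] at this
      rw [this, norm_mul, norm_mul]
      gcongr
      exacts [hA' _, hB' _, hB' _]
    · rw [gaussBinom_of_lt q (by omega), norm_zero]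
      positivity
  · rw [norm_zero]
    positivity

/-- The product `∏_{k ≥ 1} (1 - t q^k) (1 - t⁻¹ q^k) / (1 - q^k)²`. -/
def thetaProd (q t : ℂ) : ℂ :=
  ∏' k : ℕ, ((1 - t * q ^ (k + 1)) * (1 - t⁻¹ * q ^ (k + 1)) / (1 - q ^ (k + 1)) ^ 2)

/-- In this form each factor is visibly `1` plus a geometrically small term which vanishes at `t =
1`. Both the convergence of the product and its limit at `t = 1` follow. -/
theorem thetaProd_factor {q t : ℂ} (hq1 : ‖q‖ < 1) (ht : t ≠ 0) (k : ℕ) :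
    (1 - t * q ^ (k + 1)) * (1 - t⁻¹ * q ^ (k + 1)) / (1 - q ^ (k + 1)) ^ 2 =
      1 + q ^ (k + 1) * (2 - t - t⁻¹) / (1 - q ^ (k + 1)) ^ 2 := by
  have := one_sub_pow_ne_zero hq1 k
  field_simp
  ring

theorem norm_thetaProd_factor_le {q : ℂ} (hq1 : ‖q‖ < 1) (s : ℂ) (k : ℕ) :
    ‖q ^ (k + 1) * s / (1 - q ^ (k + 1)) ^ 2‖ ≤ ‖q‖ ^ (k + 1) * (‖s‖ / (1 - ‖q‖) ^ 2) := by
  have h1 : 0 < 1 - ‖q‖ := sub_pos.2 hq1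
  rw [norm_div, norm_mul, norm_pow, norm_pow, mul_div_assoc]
  gcongr
  exact one_sub_norm_le hq1 k

theorem summable_norm_pow_succ_mul {q : ℂ} (hq1 : ‖q‖ < 1) (a : ℝ) :
    Summable fun k : ℕ => ‖q‖ ^ (k + 1) * a :=
  ((summable_nat_add_iff 1).2 (summable_geometric_of_lt_one (norm_nonneg q) hq1)).mul_right a

theorem multipliable_thetaProd {q t : ℂ} (hq1 : ‖q‖ < 1) (ht : t ≠ 0) :
    Multipliable fun k : ℕ =>
      (1 - t * q ^ (k + 1)) * (1 - t⁻¹ * q ^ (k + 1)) / (1 - q ^ (k + 1)) ^ 2 := by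
  simp_rw [thetaProd_factor hq1 ht]
  exact multipliable_one_add_of_summable (Summable.of_nonneg_of_le (fun _ => norm_nonneg _)
    (norm_thetaProd_factor_le hq1 _) (summable_norm_pow_succ_mul hq1 _))

theorem tendsto_thetaProd_one {q : ℂ} (hq1 : ‖q‖ < 1) :
    Tendsto (thetaProd q) (𝓝 1) (𝓝 1) := by
  have hne : ∀ᶠ t : ℂ in 𝓝 1, t ≠ 0 := isOpen_ne.mem_nhds one_ne_zero
  have hs : Tendsto (fun t : ℂ => 2 - t - t⁻¹) (𝓝 1) (𝓝 0) := by
    have : ContinuousAt (fun t : ℂ => 2 - t - t⁻¹) 1 := by fun_prop (disch := norm_num)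
    convert this.tendsto using 2
    norm_num
  have hlim : Tendsto (fun t : ℂ => ∏' k : ℕ,
      (1 + q ^ (k + 1) * (2 - t - t⁻¹) / (1 - q ^ (k + 1)) ^ 2)) (𝓝 1)
      (𝓝 (∏' _ : ℕ, (1 + (0 : ℂ)))) := by
    refine tendsto_tprod_one_add_of_dominated_convergence
      (summable_norm_pow_succ_mul hq1 (1 / (1 - ‖q‖) ^ 2)) (fun k => ?_) ?_
    · simpa using (hs.const_mul (q ^ (k + 1))).div_const ((1 - q ^ (k + 1)) ^ 2)
    · have h1 : ∀ᶠ t : ℂ in 𝓝 1, ‖2 - t - t⁻¹‖ < 1 :=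
        hs.norm.eventually (gt_mem_nhds (by simp))
      filter_upwards [h1] with t ht k
      refine (norm_thetaProd_factor_le hq1 _ k).trans ?_
      gcongr
  simp only [add_zero, tprod_one] at hlim
  refine hlim.congr' ?_
  filter_upwards [hne] with t ht
  rw [thetaProd]
  exact (tprod_congr (thetaProd_factor hq1 ht)).symm

/-- The triple product identity, up to a constant. -/
theorem exists_one_sub_mul_thetaProd {q : ℂ} (hq : q ≠ 0) (hq1 : ‖q‖ < 1) :
    ∃ C : ℂ, C ≠ 0 ∧ ∀ t ≠ 0, (1 - t) * thetaProd q t = C * thetaSeries q t := by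
  obtain ⟨c, hc, hlim⟩ := exists_tendsto_qFactorial hq1
  obtain ⟨K, hK⟩ := exists_norm_finiteTripleCoeff_le hq1 hc hlim
  refine ⟨c⁻¹ / c ^ 2, div_ne_zero (inv_ne_zero hc) (pow_ne_zero _ hc), fun t ht => ?_⟩
  have h1 : Tendsto (fun N => ∑' n : ℤ, finiteTripleCoeff q N n * (thetaCoeff q n * t ^ n)) atTop
      (𝓝 (∑' n : ℤ, c⁻¹ * (thetaCoeff q n * t ^ n))) := by
    refine tendsto_tsum_of_dominated_convergence
      (bound := fun n : ℤ => K * ‖thetaCoeff q n * t ^ n‖)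
      ((summable_norm_thetaSeries hq hq1 ht).mul_left K)
      (fun n => (tendsto_finiteTripleCoeff hq1 hc hlim n).mul_const _)
      (Eventually.of_forall fun N n => ?_)
    rw [norm_mul]
    exact mul_le_mul_of_nonneg_right (hK N n) (norm_nonneg _)
  rw [tsum_mul_left] at h1
  have h2 : Tendsto (fun N : ℕ => 1 - t * q ^ N) atTop (𝓝 (1 - t * 0)) :=
    ((tendsto_pow_atTop_nhds_zero_of_norm_lt_one hq1).const_mul t).const_sub 1
  have h3 := ((multipliable_thetaProd hq1 ht).tendsto_prod_tprod_nat.const_mul (1 - t)).mul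
    (hlim.pow 2)
  have h4 := h1.mul h2
  -- The finite product starts at `1 - t` and stops one factor short of `1 - t q^N`. Supplying that
  -- factor, which tends to `1`, makes the two products match.
  have h5 : ∀ N : ℕ, (∑' n : ℤ, finiteTripleCoeff q N n * (thetaCoeff q n * t ^ n)) *
      (1 - t * q ^ N) = (1 - t) * (∏ k ∈ Finset.range N, ((1 - t * q ^ (k + 1)) *
        (1 - t⁻¹ * q ^ (k + 1)) / (1 - q ^ (k + 1)) ^ 2)) * qFactorial q N ^ 2 := by
    intro N
    have h6 : (∏ k ∈ Finset.range N, (1 - t * q ^ k)) * (1 - t * q ^ N) =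
        (∏ k ∈ Finset.range N, (1 - t * q ^ (k + 1))) * (1 - t) := by
      rw [← Finset.prod_range_succ, Finset.prod_range_succ']; simp
    rw [← finite_triple_product hq ht, mul_right_comm, h6, Finset.prod_div_distrib,
      Finset.prod_mul_distrib, Finset.prod_pow]
    have := qFactorial_ne_zero hq1 N
    rw [← qFactorial]
    field_simp
  simp_rw [h5] at h4
  have := tendsto_nhds_unique h3 h4
  rw [thetaProd, thetaSeries]
  field_simp at this ⊢
  simp only [mul_zero, sub_zero, mul_one] at this
  rw [← this]

/-! ### Kronecker's formula -/

/-- The coefficients of Kronecker's series approach `1` at `+∞` and `0` at `-∞`, both at the rate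
`|q|^m`. Hence the series converges on the annulus `|q| < |t| < 1`. -/
theorem exists_norm_inv_one_sub_le {q ζ : ℂ} (hq : q ≠ 0) (hq1 : ‖q‖ < 1) (hζ0 : ζ ≠ 0)
    (hζ : ∀ m : ℤ, ζ * q ^ m ≠ 1) :
    ∃ K : ℝ, 0 ≤ K ∧ (∀ m : ℕ, ‖1 / (1 - ζ * q ^ (m : ℤ)) - 1‖ ≤ K * ‖q‖ ^ m) ∧
      ∀ m : ℕ, ‖1 / (1 - ζ * q ^ (-(m : ℤ)))‖ ≤ K * ‖q‖ ^ m := by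
  have hpow := tendsto_pow_atTop_nhds_zero_of_norm_lt_one hq1
  have h1 : Tendsto (fun m : ℕ => (1 - ζ * q ^ m)⁻¹) atTop (𝓝 (1 - ζ * 0)⁻¹) :=
    ((hpow.const_mul ζ).const_sub 1).inv₀ (by simp)
  have h2 : Tendsto (fun m : ℕ => (q ^ m - ζ)⁻¹) atTop (𝓝 (0 - ζ)⁻¹) :=
    (hpow.sub_const ζ).inv₀ (by simpa using hζ0)
  obtain ⟨A, hA⟩ := (Metric.isBounded_range_of_tendsto _ h1).exists_norm_le
  obtain ⟨B, hB⟩ := (Metric.isBounded_range_of_tendsto _ h2).exists_norm_le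
  have hA' : ∀ m : ℕ, ‖(1 - ζ * q ^ m)⁻¹‖ ≤ A := fun m => hA _ ⟨m, rfl⟩
  have hB' : ∀ m : ℕ, ‖(q ^ m - ζ)⁻¹‖ ≤ B := fun m => hB _ ⟨m, rfl⟩
  refine ⟨max (‖ζ‖ * A) B, le_max_of_le_right ((norm_nonneg _).trans (hB' 0)), fun m => ?_,
    fun m => ?_⟩
  · have h3 : 1 - ζ * q ^ m ≠ 0 := sub_ne_zero.2 fun h => hζ m (by simpa using h.symm)
    have h4 : 1 / (1 - ζ * q ^ (m : ℤ)) - 1 = ζ * (1 - ζ * q ^ m)⁻¹ * q ^ m := by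
      rw [zpow_natCast]
      field_simp
      ring
    rw [h4, norm_mul, norm_mul, norm_pow]
    gcongr
    refine le_max_of_le_left ?_
    gcongr
    exact hA' m
  · have h4 : 1 / (1 - ζ * q ^ (-(m : ℤ))) = (q ^ m - ζ)⁻¹ * q ^ m := by
      have h5 : q ^ m ≠ 0 := pow_ne_zero _ hq
      have h6 : 1 - ζ * (q ^ m)⁻¹ ≠ 0 :=
        sub_ne_zero.2 fun h => hζ (-m) (by rw [zpow_neg, zpow_natCast]; exact h.symm)
      have h7 : q ^ m - ζ ≠ 0 := by
        intro h
        apply h6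
        field_simp
        rw [h, mul_zero]
      rw [zpow_neg, zpow_natCast]
      field_simp
    rw [h4, norm_mul, norm_pow]
    gcongr
    exact le_max_of_le_right (hB' m)

theorem exists_norm_inv_one_sub_le_const {q ζ : ℂ} (hq : q ≠ 0) (hq1 : ‖q‖ < 1) (hζ0 : ζ ≠ 0)
    (hζ : ∀ m : ℤ, ζ * q ^ m ≠ 1) : ∃ K : ℝ, ∀ m : ℤ, ‖1 / (1 - ζ * q ^ m)‖ ≤ K := by
  obtain ⟨K, hK0, h1, h2⟩ := exists_norm_inv_one_sub_le hq hq1 hζ0 hζ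
  have h3 : ∀ m : ℕ, K * ‖q‖ ^ m ≤ K := fun m =>
    mul_le_of_le_one_right hK0 (pow_le_one₀ (norm_nonneg _) hq1.le)
  refine ⟨1 + K, fun m => ?_⟩
  obtain ⟨n, rfl | rfl⟩ := m.eq_nat_or_neg
  · have h4 := norm_add_le (1 : ℂ) (1 / (1 - ζ * q ^ (n : ℤ)) - 1)
    rw [add_sub_cancel, norm_one] at h4
    linarith [h1 n, h3 n]
  · linarith [h2 n, h3 n]

/-- Kronecker's series `∑ t^m / (1 - ζ q^m)`. -/
def kroneckerSeries (q ζ t : ℂ) : ℂ := ∑' m : ℤ, t ^ m * (1 / (1 - ζ * q ^ m))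

theorem summable_kronecker_nat {q ζ t : ℂ} (hq : q ≠ 0) (hq1 : ‖q‖ < 1) (hζ0 : ζ ≠ 0)
    (hζ : ∀ m : ℤ, ζ * q ^ m ≠ 1) (ht1 : ‖t‖ < 1) :
    Summable fun m : ℕ => t ^ (m : ℤ) * (1 / (1 - ζ * q ^ (m : ℤ))) := by
  obtain ⟨K, hK⟩ := exists_norm_inv_one_sub_le_const hq hq1 hζ0 hζ
  refine Summable.of_norm_bounded
    ((summable_geometric_of_lt_one (norm_nonneg t) ht1).mul_right K) fun m => ?_
  rw [norm_mul, zpow_natCast, norm_pow]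
  gcongr
  exact hK m

theorem norm_zpow_neg_mul_le {q ζ t : ℂ} {K : ℝ} (m : ℕ)
    (h : ‖1 / (1 - ζ * q ^ (-(m : ℤ)))‖ ≤ K * ‖q‖ ^ m) :
    ‖t ^ (-(m : ℤ)) * (1 / (1 - ζ * q ^ (-(m : ℤ))))‖ ≤ K * (‖q‖ / ‖t‖) ^ m := by
  have h1 : K * (‖q‖ / ‖t‖) ^ m = (‖t‖ ^ m)⁻¹ * (K * ‖q‖ ^ m) := by rw [div_pow]; ring
  rw [norm_mul, zpow_neg t, zpow_natCast, norm_inv, norm_pow, h1]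
  gcongr

theorem summable_kronecker_neg {q ζ t : ℂ} (hq : q ≠ 0) (hq1 : ‖q‖ < 1) (hζ0 : ζ ≠ 0)
    (hζ : ∀ m : ℤ, ζ * q ^ m ≠ 1) (hqt : ‖q‖ < ‖t‖) :
    Summable fun m : ℕ => t ^ (-(m : ℤ)) * (1 / (1 - ζ * q ^ (-(m : ℤ)))) := by
  obtain ⟨K, -, -, h2⟩ := exists_norm_inv_one_sub_le hq hq1 hζ0 hζ
  have ht : 0 < ‖t‖ := (norm_nonneg q).trans_lt hqt
  exact Summable.of_norm_bounded
    ((summable_geometric_of_lt_one (by positivity) ((div_lt_one ht).2 hqt)).mul_left K)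
    fun m => norm_zpow_neg_mul_le m (h2 m)

theorem summable_kroneckerSeries {q ζ t : ℂ} (hq : q ≠ 0) (hq1 : ‖q‖ < 1) (hζ0 : ζ ≠ 0)
    (hζ : ∀ m : ℤ, ζ * q ^ m ≠ 1) (hqt : ‖q‖ < ‖t‖) (ht1 : ‖t‖ < 1) :
    Summable fun m : ℤ => t ^ m * (1 / (1 - ζ * q ^ m)) :=
  Summable.of_nat_of_neg (summable_kronecker_nat hq hq1 hζ0 hζ ht1)
    (summable_kronecker_neg hq hq1 hζ0 hζ hqt)

/-- The change of variables `(N, n) ↦ (n + N, -n)` of `ℤ × ℤ`. -/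
def shearEquiv : ℤ × ℤ ≃ ℤ × ℤ where
  toFun p := (p.2 + p.1, -p.2)
  invFun p := (p.1 + p.2, -p.2)
  left_inv p := by ext <;> simp
  right_inv p := by ext <;> simp

theorem summable_thetaCoeff_div {q ζ : ℂ} (hq : q ≠ 0) (hq1 : ‖q‖ < 1) (hζ0 : ζ ≠ 0)
    (hζ : ∀ m : ℤ, ζ * q ^ m ≠ 1) (N : ℤ) :
    Summable fun n : ℤ => thetaCoeff q n * (q ^ N) ^ n * (1 / (1 - ζ * q ^ (-n))) := by
  obtain ⟨K, hK⟩ := exists_norm_inv_one_sub_le_const hq hq1 hζ0 hζ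
  refine Summable.of_norm_bounded
    ((summable_norm_thetaSeries hq hq1 (zpow_ne_zero N hq)).mul_right K) fun n => ?_
  rw [norm_mul]
  gcongr
  exact hK _

/-- With `e_N` the left side, the denominators cancel in `e_{N+1} - ζ e_N`, which becomes the theta
series at `q^{N+1}` and so vanishes. -/
theorem tsum_thetaCoeff_div_eq {q ζ : ℂ} (hq : q ≠ 0) (hq1 : ‖q‖ < 1) (hζ0 : ζ ≠ 0)
    (hζ : ∀ m : ℤ, ζ * q ^ m ≠ 1) (N : ℤ) :
    ∑' n : ℤ, thetaCoeff q n * (q ^ N) ^ n * (1 / (1 - ζ * q ^ (-n))) =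
      ζ ^ N * ∑' n : ℤ, thetaCoeff q n * (1 / (1 - ζ * q ^ (-n))) := by
  set e : ℤ → ℂ := fun N => ∑' n : ℤ, thetaCoeff q n * (q ^ N) ^ n * (1 / (1 - ζ * q ^ (-n)))
    with he
  have hrec : ∀ N, e (N + 1) = ζ * e N := by
    intro N
    rw [← sub_eq_zero, he]
    simp only
    rw [← tsum_mul_left, ← (summable_thetaCoeff_div hq hq1 hζ0 hζ (N + 1)).tsum_sub
      ((summable_thetaCoeff_div hq hq1 hζ0 hζ N).mul_left ζ), ← thetaSeries_zpow hq (N + 1),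
      thetaSeries]
    refine tsum_congr fun n => ?_
    have h1 : 1 - ζ * q ^ (-n) ≠ 0 := sub_ne_zero.2 (hζ (-n)).symm
    have h2 : (q ^ (N + 1)) ^ n = (q ^ N) ^ n * q ^ n := by rw [zpow_add_one₀ hq, mul_zpow]
    have h3 : q ^ n * q ^ (-n) = 1 := by rw [← zpow_add₀ hq, add_neg_cancel, zpow_zero]
    rw [h2]
    field_simp
    linear_combination (ζ * thetaCoeff q n) * h3
  have h0 : e 0 = ∑' n : ℤ, thetaCoeff q n * (1 / (1 - ζ * q ^ (-n))) := by simp [he]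
  rw [← h0]
  change e N = _
  induction N using Int.induction_on with
  | zero => simp
  | succ n ih => rw [hrec, ih, zpow_add_one₀ hζ0]; ring
  | pred n ih =>
    have h1 := hrec (-(n : ℤ) - 1)
    rw [sub_add_cancel, ih] at h1
    rw [zpow_sub_one₀ hζ0]
    field_simp
    rw [mul_comm, ← h1]

/-- Compare powers of `t` in the product of the two series. The coefficient of `t^N` is `thetaCoeff
q N` times the sum evaluated in `tsum_thetaCoeff_div_eq`, so it contributes `ζ^N`. -/
theorem thetaSeries_mul_kroneckerSeries {q ζ t : ℂ} (hq : q ≠ 0) (hq1 : ‖q‖ < 1) (hζ0 : ζ ≠ 0)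
    (hζ : ∀ m : ℤ, ζ * q ^ m ≠ 1) (hqt : ‖q‖ < ‖t‖) (ht1 : ‖t‖ < 1) :
    thetaSeries q t * kroneckerSeries q ζ t =
      (∑' n : ℤ, thetaCoeff q n * (1 / (1 - ζ * q ^ (-n)))) * thetaSeries q (t * ζ) := by
  have ht : t ≠ 0 := norm_pos_iff.1 ((norm_nonneg q).trans_lt hqt)
  have s1 := summable_norm_thetaSeries hq hq1 ht
  have s2 := (summable_kroneckerSeries hq hq1 hζ0 hζ hqt ht1).norm
  have s3 := summable_mul_of_summable_norm s1 s2
  -- After the shear the first index `N` is the total power of `t`.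
  rw [thetaSeries, kroneckerSeries, tsum_mul_tsum_of_summable_norm s1 s2,
    ← shearEquiv.tsum_eq]
  refine ((shearEquiv.summable_iff.2 s3).tsum_prod).trans ?_
  rw [thetaSeries, ← tsum_mul_left]
  refine tsum_congr fun N => ?_
  have h1 : ∀ n : ℤ, thetaCoeff q (n + N) * t ^ (n + N) * (t ^ (-n) * (1 / (1 - ζ * q ^ (-n)))) =
      thetaCoeff q N * t ^ N * (thetaCoeff q n * (q ^ N) ^ n * (1 / (1 - ζ * q ^ (-n)))) := by
    intro n
    have h2 : t ^ n * t ^ (-n) = 1 := by rw [← zpow_add₀ ht, add_neg_cancel, zpow_zero]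
    rw [thetaCoeff_add hq, zpow_add₀ ht, ← zpow_mul, mul_comm N n]
    linear_combination thetaCoeff q n * thetaCoeff q N * q ^ (n * N) * t ^ N *
      (1 / (1 - ζ * q ^ (-n))) * h2
  calc _ = ∑' n : ℤ, thetaCoeff q (n + N) * t ^ (n + N) *
        (t ^ (-n) * (1 / (1 - ζ * q ^ (-n)))) := rfl
    _ = _ := by
      simp_rw [h1]
      rw [tsum_mul_left, tsum_thetaCoeff_div_eq hq hq1 hζ0 hζ, mul_zpow]
      ring

theorem kroneckerSeries_eq_add {q ζ t : ℂ} (hq : q ≠ 0) (hq1 : ‖q‖ < 1) (hζ0 : ζ ≠ 0)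
    (hζ : ∀ m : ℤ, ζ * q ^ m ≠ 1) (hqt : ‖q‖ < ‖t‖) (ht1 : ‖t‖ < 1) :
    kroneckerSeries q ζ t = (1 - t)⁻¹ + (∑' m : ℕ, t ^ m * (1 / (1 - ζ * q ^ (m : ℤ)) - 1) +
      ∑' m : ℕ, t ^ (-((m : ℤ) + 1)) * (1 / (1 - ζ * q ^ (-((m : ℤ) + 1))))) := by
  have hgeom := summable_geometric_of_norm_lt_one ht1
  have hnat := summable_kronecker_nat hq hq1 hζ0 hζ ht1
  have hneg : Summable fun m : ℕ =>
      t ^ (-((m : ℤ) + 1)) * (1 / (1 - ζ * q ^ (-((m : ℤ) + 1)))) :=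
    ((summable_nat_add_iff 1).2 (summable_kronecker_neg hq hq1 hζ0 hζ hqt)).congr fun m => by
      rw [Nat.cast_succ]
  have hsplit : kroneckerSeries q ζ t = ∑' m : ℕ, t ^ (m : ℤ) * (1 / (1 - ζ * q ^ (m : ℤ))) +
      ∑' m : ℕ, t ^ (-((m : ℤ) + 1)) * (1 / (1 - ζ * q ^ (-((m : ℤ) + 1)))) :=
    tsum_of_nat_of_neg_add_one (f := fun m : ℤ => t ^ m * (1 / (1 - ζ * q ^ m))) hnat hneg
  have hpos : ∑' m : ℕ, t ^ m * (1 / (1 - ζ * q ^ (m : ℤ)) - 1) =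
      ∑' m : ℕ, t ^ (m : ℤ) * (1 / (1 - ζ * q ^ (m : ℤ))) - ∑' m : ℕ, t ^ m := by
    rw [← hnat.tsum_sub hgeom]
    refine tsum_congr fun m => ?_
    rw [zpow_natCast t]
    ring
  rw [hsplit, hpos, tsum_geometric_of_norm_lt_one ht1]
  ring

/-- The singular part at `t = 1` is the geometric series. The remainder stays bounded as `t`
increases to `1`. -/
theorem tendsto_one_sub_mul_kroneckerSeries {q ζ : ℂ} (hq : q ≠ 0) (hq1 : ‖q‖ < 1) (hζ0 : ζ ≠ 0)
    (hζ : ∀ m : ℤ, ζ * q ^ m ≠ 1) :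
    Tendsto (fun s : ℝ => (1 - (s : ℂ)) * kroneckerSeries q ζ s) (𝓝[<] 1) (𝓝 1) := by
  obtain ⟨K, hK0, hK1, hK2⟩ := exists_norm_inv_one_sub_le hq hq1 hζ0 hζ
  -- Keeping `s > r > |q|` bounds the terms of negative index by a geometric series of ratio `|q| /
  -- r`, independent of `s`.
  obtain ⟨r, hr, hr1⟩ := exists_between hq1
  have hr0 : 0 < r := (norm_nonneg q).trans_lt hr
  have hqr : ‖q‖ / r < 1 := (div_lt_one hr0).2 hr
  set M : ℝ := K * (1 - ‖q‖)⁻¹ + K * (1 - ‖q‖ / r)⁻¹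
  have hev : ∀ᶠ s : ℝ in 𝓝[<] 1, r < s ∧ s < 1 :=
    (eventually_nhdsWithin_of_eventually_nhds (lt_mem_nhds hr1)).and self_mem_nhdsWithin
  have hbound : ∀ᶠ s : ℝ in 𝓝[<] 1,
      ‖(1 - (s : ℂ)) * kroneckerSeries q ζ s - 1‖ ≤ (1 - s) * M := by
    filter_upwards [hev] with s hs
    have hs0 : 0 < s := hr0.trans hs.1
    have hns : ‖(s : ℂ)‖ = s := by rw [Complex.norm_real, Real.norm_of_nonneg hs0.le]
    have hs1 : ‖(s : ℂ)‖ < 1 := by rw [hns]; exact hs.2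
    have hqs : ‖q‖ < ‖(s : ℂ)‖ := by rw [hns]; exact hr.trans hs.1
    have hsplit := kroneckerSeries_eq_add hq hq1 hζ0 hζ hqs hs1
    have b1 : ‖∑' m : ℕ, (s : ℂ) ^ m * (1 / (1 - ζ * q ^ (m : ℤ)) - 1)‖ ≤
        K * (1 - ‖q‖)⁻¹ := by
      refine tsum_of_norm_bounded
        ((hasSum_geometric_of_lt_one (norm_nonneg q) hq1).mul_left K) fun m => ?_
      rw [norm_mul, norm_pow]
      exact (mul_le_of_le_one_left (norm_nonneg _) (pow_le_one₀ (norm_nonneg _) hs1.le)).trans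
        (hK1 m)
    have b2 : ‖∑' m : ℕ, (s : ℂ) ^ (-((m : ℤ) + 1)) * (1 / (1 - ζ * q ^ (-((m : ℤ) + 1))))‖ ≤
        K * (1 - ‖q‖ / r)⁻¹ := by
      refine tsum_of_norm_bounded
        ((hasSum_geometric_of_lt_one (by positivity) hqr).mul_left K) fun m => ?_
      have := norm_zpow_neg_mul_le (t := (s : ℂ)) (m + 1) (hK2 (m + 1))
      rw [Nat.cast_add, Nat.cast_one] at this
      refine this.trans ?_
      rw [hns]
      gcongr
      calc (‖q‖ / s) ^ (m + 1) ≤ (‖q‖ / s) ^ m :=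
            pow_le_pow_of_le_one (by positivity) ((div_le_one hs0).2 (hr.trans hs.1).le)
              (Nat.le_succ m)
        _ ≤ (‖q‖ / r) ^ m := by gcongr; exact hs.1.le
    have h1s : (1 - (s : ℂ)) ≠ 0 := by
      rw [sub_ne_zero]
      exact_mod_cast hs.2.ne'
    have hn1 : ‖1 - (s : ℂ)‖ = 1 - s := by
      rw [← Complex.ofReal_one, ← Complex.ofReal_sub, Complex.norm_real,
        Real.norm_of_nonneg (by linarith [hs.2])]
    rw [hsplit, mul_add, mul_inv_cancel₀ h1s, add_sub_cancel_left, norm_mul, hn1]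
    refine mul_le_mul_of_nonneg_left ?_ (by linarith [hs.2])
    exact (norm_add_le _ _).trans (add_le_add b1 b2)
  rw [tendsto_iff_norm_sub_tendsto_zero]
  refine squeeze_zero' (Eventually.of_forall fun _ => norm_nonneg _) hbound ?_
  have : Tendsto (fun s : ℝ => (1 - s) * M) (𝓝 1) (𝓝 ((1 - 1) * M)) :=
    (tendsto_id.const_sub 1).mul_const M
  simp only [sub_self, zero_mul] at this
  exact this.mono_left nhdsWithin_le_nhds

theorem tendsto_thetaSeries_mul {q ζ : ℂ} (hq : q ≠ 0) (hq1 : ‖q‖ < 1) (hζ0 : ζ ≠ 0) :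
    Tendsto (fun s : ℝ => thetaSeries q (s * ζ)) (𝓝[<] 1) (𝓝 (thetaSeries q ζ)) := by
  have s1 := summable_norm_thetaSeries hq hq1 hζ0
  -- For `1/2 < s < 1` one has `s^n ≤ 1 + (1/2)^n` for `n` of either sign, so the series at `ζ` and
  -- at `ζ / 2` together dominate.
  have s2 := summable_norm_thetaSeries hq hq1 (t := (1 / 2) * ζ) (by simpa using hζ0)
  refine tendsto_tsum_of_dominated_convergence (s1.add s2) (fun n => ?_) ?_
  · have h1 : ContinuousAt (fun s : ℝ => thetaCoeff q n * ((s : ℂ) * ζ) ^ n) 1 := by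
      refine ContinuousAt.mul continuousAt_const (ContinuousAt.zpow₀ (by fun_prop) _ ?_)
      left
      simpa using hζ0
    have := h1.tendsto
    simp only [Complex.ofReal_one, one_mul] at this
    exact this.mono_left nhdsWithin_le_nhds
  · have hev : ∀ᶠ s : ℝ in 𝓝[<] 1, 1 / 2 < s ∧ s < 1 :=
      (eventually_nhdsWithin_of_eventually_nhds (lt_mem_nhds (by norm_num))).and
        self_mem_nhdsWithin
    filter_upwards [hev] with s hs n
    have hs0 : 0 < s := lt_trans (by norm_num) hs.1
    have h1 : s ^ n ≤ 1 + (1 / 2) ^ n := by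
      obtain ⟨m, rfl | rfl⟩ := n.eq_nat_or_neg
      · have h1 : s ^ m ≤ 1 := pow_le_one₀ hs0.le hs.2.le
        have h2 : (0 : ℝ) ≤ (1 / 2) ^ m := by positivity
        simp only [zpow_natCast]
        linarith
      · have h1 : (s ^ m)⁻¹ ≤ ((1 / 2 : ℝ) ^ m)⁻¹ := by
          gcongr
          exact hs.1.le
        simp only [zpow_neg, zpow_natCast]
        linarith
    have h2 : ‖(1 / 2 : ℂ)‖ = 1 / 2 := by norm_num
    simp only [norm_mul, mul_zpow, norm_zpow, Complex.norm_real, Real.norm_of_nonneg hs0.le, h2]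
    calc ‖thetaCoeff q n‖ * (s ^ n * ‖ζ‖ ^ n) ≤
          ‖thetaCoeff q n‖ * ((1 + (1 / 2) ^ n) * ‖ζ‖ ^ n) := by gcongr
      _ = _ := by ring

/-- The product `(1 - t) ∏_{k ≥ 1} (1 - t q^k) (1 - t⁻¹ q^k) / (1 - q^k)²`. -/
def thetaProd₀ (q t : ℂ) : ℂ := (1 - t) * thetaProd q t

/-- Let `t` increase to `1` in `thetaSeries_mul_kroneckerSeries`: this fixes the unknown factor
there. The constant of the triple product cancels and is never evaluated. -/
theorem tsum_thetaCoeff_div_mul_thetaProd₀ {q ζ : ℂ} (hq : q ≠ 0) (hq1 : ‖q‖ < 1) (hζ0 : ζ ≠ 0)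
    (hζ : ∀ m : ℤ, ζ * q ^ m ≠ 1) :
    (∑' n : ℤ, thetaCoeff q n * (1 / (1 - ζ * q ^ (-n)))) * thetaProd₀ q ζ = 1 := by
  obtain ⟨C, -, hC⟩ := exists_one_sub_mul_thetaProd hq hq1
  set b := ∑' n : ℤ, thetaCoeff q n * (1 / (1 - ζ * q ^ (-n)))
  have hcast : Tendsto (fun s : ℝ => (s : ℂ)) (𝓝[<] 1) (𝓝 1) := by
    have := Complex.continuous_ofReal.tendsto (1 : ℝ)
    rw [Complex.ofReal_one] at this
    exact this.mono_left nhdsWithin_le_nhds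
  have h1 := (tendsto_one_sub_mul_kroneckerSeries hq hq1 hζ0 hζ).mul
    ((tendsto_thetaProd_one hq1).comp hcast)
  have h2 := (tendsto_thetaSeries_mul hq hq1 hζ0).const_mul (C * b)
  have hev : ∀ᶠ s : ℝ in 𝓝[<] 1, ‖q‖ < s ∧ s < 1 :=
    (eventually_nhdsWithin_of_eventually_nhds (lt_mem_nhds hq1)).and self_mem_nhdsWithin
  have h3 : ∀ᶠ s : ℝ in 𝓝[<] 1, C * b * thetaSeries q (s * ζ) =
      (1 - (s : ℂ)) * kroneckerSeries q ζ s * (thetaProd q ∘ fun s : ℝ => (s : ℂ)) s := by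
    filter_upwards [hev] with s hs
    have hs0 : 0 < s := (norm_nonneg q).trans_lt hs.1
    have hns : ‖(s : ℂ)‖ = s := by rw [Complex.norm_real, Real.norm_of_nonneg hs0.le]
    have h4 := thetaSeries_mul_kroneckerSeries hq hq1 hζ0 hζ (t := s) (by rw [hns]; exact hs.1)
      (by rw [hns]; exact hs.2)
    have h5 := hC s (by exact_mod_cast hs0.ne')
    simp only [Function.comp]
    linear_combination (-C) * h4 - kroneckerSeries q ζ s * h5
  have h4 := tendsto_nhds_unique (h2.congr' h3) h1
  rw [thetaProd₀, hC ζ hζ0]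
  linear_combination h4

/-- An inverse has just been exhibited, so the zeros of the infinite product need no separate study.
-/
theorem thetaProd₀_ne_zero {q ζ : ℂ} (hq : q ≠ 0) (hq1 : ‖q‖ < 1) (hζ0 : ζ ≠ 0)
    (hζ : ∀ m : ℤ, ζ * q ^ m ≠ 1) : thetaProd₀ q ζ ≠ 0 :=
  right_ne_zero_of_mul_eq_one (tsum_thetaCoeff_div_mul_thetaProd₀ hq hq1 hζ0 hζ)

theorem mul_zpow_ne_one_of_norm {q t : ℂ} (hq : q ≠ 0) (hq1 : ‖q‖ < 1) (hqt : ‖q‖ < ‖t‖)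
    (ht1 : ‖t‖ < 1) (m : ℤ) : t * q ^ m ≠ 1 := by
  intro h
  have hq0 : 0 < ‖q‖ := norm_pos_iff.2 hq
  have h1 : ‖t‖ * ‖q‖ ^ m = 1 := by rw [← norm_zpow, ← norm_mul, h, norm_one]
  rcases le_or_gt 0 m with hm | hm
  · have : ‖q‖ ^ m ≤ 1 := zpow_le_one₀ hq0 hq1.le hm
    nlinarith [norm_nonneg t]
  · have h2 : ‖q‖ ^ m ≥ ‖q‖ ^ (-1 : ℤ) := zpow_le_zpow_right_of_le_one₀ hq0 hq1.le (by omega)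
    rw [zpow_neg_one] at h2
    have h3 : ‖q‖ * ‖q‖⁻¹ = 1 := mul_inv_cancel₀ hq0.ne'
    have h4 : 0 < ‖q‖⁻¹ := inv_pos.2 hq0
    nlinarith

/-- Kronecker's formula. -/
theorem thetaProd₀_mul_eq {q ζ t : ℂ} (hq : q ≠ 0) (hq1 : ‖q‖ < 1) (hζ0 : ζ ≠ 0)
    (hζ : ∀ m : ℤ, ζ * q ^ m ≠ 1) (hqt : ‖q‖ < ‖t‖) (ht1 : ‖t‖ < 1) :
    thetaProd₀ q (t * ζ) = thetaProd₀ q t * thetaProd₀ q ζ * kroneckerSeries q ζ t := by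
  obtain ⟨C, -, hC⟩ := exists_one_sub_mul_thetaProd hq hq1
  have ht : t ≠ 0 := norm_pos_iff.1 ((norm_nonneg q).trans_lt hqt)
  have h1 := thetaSeries_mul_kroneckerSeries hq hq1 hζ0 hζ hqt ht1
  have h2 := tsum_thetaCoeff_div_mul_thetaProd₀ hq hq1 hζ0 hζ
  have h3 := hC t ht
  have h4 := hC (t * ζ) (mul_ne_zero ht hζ0)
  rw [← thetaProd₀] at h3 h4
  rw [h4, h3]
  linear_combination (-C * thetaSeries q (t * ζ)) * h2 - C * thetaProd₀ q ζ * h1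

/-! ### The functions `Φ` and `φ`, and the expansion of `φ` on both halves of the strip -/

theorem expTwoPiI_add (x y : ℂ) : expTwoPiI (x + y) = expTwoPiI x * expTwoPiI y := by
  rw [expTwoPiI, mul_add, Complex.exp_add]; rfl

theorem expTwoPiI_ne_zero (x : ℂ) : expTwoPiI x ≠ 0 := Complex.exp_ne_zero _

@[simp] theorem expTwoPiI_zero : expTwoPiI 0 = 1 := by simp [expTwoPiI]

theorem expTwoPiI_neg (x : ℂ) : expTwoPiI (-x) = (expTwoPiI x)⁻¹ := by
  rw [expTwoPiI, mul_neg, Complex.exp_neg]; rfl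

theorem expTwoPiI_zsmul (m : ℤ) (x : ℂ) : expTwoPiI (m * x) = expTwoPiI x ^ m := by
  rw [expTwoPiI, expTwoPiI, ← Complex.exp_int_mul]
  congr 1
  ring

theorem expTwoPiI_sum {ι : Type*} (s : Finset ι) (f : ι → ℂ) :
    expTwoPiI (∑ i ∈ s, f i) = ∏ i ∈ s, expTwoPiI (f i) := by
  simp only [expTwoPiI, Finset.mul_sum, Complex.exp_sum]

theorem expTwoPiI_eq_one_iff {x : ℂ} : expTwoPiI x = 1 ↔ ∃ n : ℤ, x = n := by
  rw [expTwoPiI, Complex.exp_eq_one_iff]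
  have := Complex.two_pi_I_ne_zero
  refine exists_congr fun n => ⟨fun h => ?_, fun h => ?_⟩
  · apply mul_left_cancel₀ this
    rw [h]; ring
  · rw [h]; ring

theorem norm_expTwoPiI (x : ℂ) : ‖expTwoPiI x‖ = Real.exp (-(2 * Real.pi * x.im)) := by
  rw [expTwoPiI, Complex.norm_exp]
  congr 1
  simp

theorem norm_expTwoPiI_lt {x y : ℂ} (h : x.im < y.im) : ‖expTwoPiI y‖ < ‖expTwoPiI x‖ := by
  rw [norm_expTwoPiI, norm_expTwoPiI, Real.exp_lt_exp]
  have := Real.pi_pos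
  nlinarith

theorem norm_expTwoPiI_lt_one {x : ℂ} (h : 0 < x.im) : ‖expTwoPiI x‖ < 1 := by
  have := norm_expTwoPiI_lt (x := 0) (y := x) (by simpa using h)
  simpa using this

theorem jacobiPhi_eq (z τ : ℂ) :
    jacobiPhi z τ = -(expTwoPiI (-z / 2) * thetaProd₀ (expTwoPiI τ) (expTwoPiI z)) := by
  have h1 : jacobiPhi z τ = (expTwoPiI (z / 2) - expTwoPiI (-z / 2)) *
    thetaProd (expTwoPiI τ) (expTwoPiI z) := rfl
  have h2 : expTwoPiI (z / 2) = expTwoPiI (-z / 2) * expTwoPiI z := by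
    rw [← expTwoPiI_add]; congr 1; ring
  rw [h1, h2, thetaProd₀]
  ring

theorem thetaProd_inv (q t : ℂ) : thetaProd q t⁻¹ = thetaProd q t := by
  simp only [thetaProd, inv_inv]
  exact tprod_congr fun k => by rw [mul_comm (1 - t⁻¹ * q ^ (k + 1))]

theorem jacobiPhi_neg (z τ : ℂ) : jacobiPhi (-z) τ = -jacobiPhi z τ := by
  have h1 : ∀ z, jacobiPhi z τ = (expTwoPiI (z / 2) - expTwoPiI (-z / 2)) *
    thetaProd (expTwoPiI τ) (expTwoPiI z) := fun _ => rfl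
  rw [h1, h1, expTwoPiI_neg, thetaProd_inv, neg_neg]
  ring

theorem ellipticPhi_neg_neg (z τ σ : ℂ) : ellipticPhi (-z) τ (-σ) = ellipticPhi z τ σ := by
  rw [ellipticPhi, ellipticPhi, ← neg_add, jacobiPhi_neg, jacobiPhi_neg, neg_div_neg_eq]

theorem ellipticPhi_eq_kroneckerSeries {z τ σ : ℂ} (h0 : 0 < z.im) (h1 : z.im < τ.im)
    (hσ : ∀ m : ℤ, expTwoPiI σ * expTwoPiI τ ^ m ≠ 1) :
    ellipticPhi z τ σ =
      -(jacobiPhi σ τ * kroneckerSeries (expTwoPiI τ) (expTwoPiI σ) (expTwoPiI z)) := by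
  have hq := expTwoPiI_ne_zero τ
  have hq1 := norm_expTwoPiI_lt_one (h0.trans h1)
  have hqt := norm_expTwoPiI_lt h1
  have ht1 := norm_expTwoPiI_lt_one h0
  have hne := thetaProd₀_ne_zero hq hq1 (expTwoPiI_ne_zero z)
    (mul_zpow_ne_one_of_norm hq hq1 hqt ht1)
  have hz := expTwoPiI_ne_zero (-z / 2)
  have h2 : expTwoPiI (-(z + σ) / 2) = expTwoPiI (-z / 2) * expTwoPiI (-σ / 2) := by
    rw [← expTwoPiI_add]; congr 1; ring
  rw [ellipticPhi, jacobiPhi_eq, jacobiPhi_eq, jacobiPhi_eq, expTwoPiI_add,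
    thetaProd₀_mul_eq hq hq1 (expTwoPiI_ne_zero σ) hσ hqt ht1, h2]
  generalize expTwoPiI (-z / 2) = a at hz ⊢
  field_simp

/-- The coefficients of the expansion of `φ(z, τ, σ) / Φ(σ, τ)` in powers of `e(z)`. -/
def ellipticCoeff (ε : Prop) [Decidable ε] (ζ q : ℂ) (m : ℤ) : ℂ :=
  (if ε then 1 else 0) - 1 / (1 - ζ * q ^ m)

theorem inv_mul_zpow_ne_one {q ζ : ℂ} (hζ : ∀ m : ℤ, ζ * q ^ m ≠ 1) (m : ℤ) : ζ⁻¹ * q ^ m ≠ 1 := by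
  intro h
  apply hζ (-m)
  rw [zpow_neg, ← inv_inj, mul_inv, inv_inv, h, inv_one]

/-- The identity `1 / (1 - x⁻¹) = 1 - 1 / (1 - x)` is the source of the extra `1` in the
coefficients when `Im z < 0`. -/
theorem inv_one_sub_inv_mul {q ζ : ℂ} (hq : q ≠ 0) (hζ0 : ζ ≠ 0)
    (hζ : ∀ m : ℤ, ζ * q ^ m ≠ 1) (m : ℤ) :
    1 / (1 - ζ⁻¹ * q ^ (-m)) = 1 - 1 / (1 - ζ * q ^ m) := by
  have h1 : 1 - ζ * q ^ m ≠ 0 := sub_ne_zero.2 (hζ m).symm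
  have h2 : 1 - ζ⁻¹ * q ^ (-m) ≠ 0 := sub_ne_zero.2 (inv_mul_zpow_ne_one hζ (-m)).symm
  have h3 : q ^ m ≠ 0 := zpow_ne_zero _ hq
  rw [zpow_neg] at h2 ⊢
  have h4 : ζ * q ^ m - 1 ≠ 0 := fun h => h1 (by linear_combination -h)
  have h5 : 1 - ζ⁻¹ * (q ^ m)⁻¹ = (ζ * q ^ m - 1) / (ζ * q ^ m) := by field_simp
  rw [h5, one_div_div, div_eq_iff h4, sub_mul, one_div]
  linear_combination -inv_mul_cancel₀ h1

/-- For `Im z > 0` this is Kronecker's formula. For `Im z < 0` apply it to `φ(-z, τ, -σ) = φ(z, τ,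
σ)` and replace `m` by `-m`. -/
theorem ellipticPhi_expansion {z τ σ : ℂ} (h0 : 0 < |z.im|) (h1 : |z.im| < τ.im)
    (hσ : ∀ m : ℤ, expTwoPiI σ * expTwoPiI τ ^ m ≠ 1) :
    (Summable fun m : ℤ =>
      ‖expTwoPiI z ^ m * ellipticCoeff (z.im < 0) (expTwoPiI σ) (expTwoPiI τ) m‖) ∧
    ellipticPhi z τ σ = jacobiPhi σ τ *
      ∑' m : ℤ, expTwoPiI z ^ m * ellipticCoeff (z.im < 0) (expTwoPiI σ) (expTwoPiI τ) m := by
  have hq := expTwoPiI_ne_zero τ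
  have hq1 := norm_expTwoPiI_lt_one (h0.trans h1)
  rcases lt_or_gt_of_ne (abs_pos.1 h0) with hz | hz
  · have hz0 : 0 < (-z).im := by simpa using hz
    have hz1 : (-z).im < τ.im := by rwa [abs_of_neg hz] at h1
    have hσ' : ∀ m : ℤ, expTwoPiI (-σ) * expTwoPiI τ ^ m ≠ 1 := by
      rw [expTwoPiI_neg]
      exact inv_mul_zpow_ne_one hσ
    have hterm : ∀ m : ℤ, expTwoPiI (-z) ^ (-m) *
        (1 / (1 - expTwoPiI (-σ) * expTwoPiI τ ^ (-m))) =
        expTwoPiI z ^ m * ellipticCoeff (z.im < 0) (expTwoPiI σ) (expTwoPiI τ) m := by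
      intro m
      rw [ellipticCoeff, if_pos hz, expTwoPiI_neg σ,
        inv_one_sub_inv_mul hq (expTwoPiI_ne_zero σ) hσ, expTwoPiI_neg, inv_zpow', neg_neg]
    have hsum := summable_kroneckerSeries hq hq1 (expTwoPiI_ne_zero (-σ)) hσ'
      (norm_expTwoPiI_lt hz1) (norm_expTwoPiI_lt_one hz0)
    refine ⟨?_, ?_⟩
    · simp_rw [← hterm]
      exact ((Equiv.neg ℤ).summable_iff.2 hsum).norm
    · rw [← ellipticPhi_neg_neg, ellipticPhi_eq_kroneckerSeries hz0 hz1 hσ', jacobiPhi_neg,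
        kroneckerSeries, ← (Equiv.neg ℤ).tsum_eq, neg_mul, neg_neg]
      congr 1
      exact tsum_congr hterm
  · have hz1 : z.im < τ.im := by rwa [abs_of_pos hz] at h1
    have hterm : ∀ m : ℤ, -(expTwoPiI z ^ m * (1 / (1 - expTwoPiI σ * expTwoPiI τ ^ m))) =
        expTwoPiI z ^ m * ellipticCoeff (z.im < 0) (expTwoPiI σ) (expTwoPiI τ) m := by
      intro m
      rw [ellipticCoeff, if_neg hz.not_gt]
      ring
    have hsum := summable_kroneckerSeries hq hq1 (expTwoPiI_ne_zero σ) hσ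
      (norm_expTwoPiI_lt hz1) (norm_expTwoPiI_lt_one hz)
    refine ⟨?_, ?_⟩
    · simp_rw [← hterm]
      exact hsum.neg.norm
    · simp_rw [← hterm]
      rw [ellipticPhi_eq_kroneckerSeries hz hz1 hσ, kroneckerSeries, tsum_neg]
      ring

/-! ### Products of series and sums of characters -/

/-- Products of absolutely convergent series over `β`, indexed by the finite type `κ`, may be
expanded. -/
def ProdTsum (β κ : Type*) [Fintype κ] : Prop :=
  ∀ f : κ → β → ℂ, (∀ i, Summable fun b => ‖f i b‖) →
    (Summable fun m : κ → β => ‖∏ i, f i (m i)‖) ∧ ∏ i, ∑' b, f i b = ∑' m : κ → β, ∏ i, f i (m i)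

theorem ProdTsum.congr {α β γ : Type*} [Fintype α] [Fintype γ] (e : α ≃ γ) (h : ProdTsum β α) :
    ProdTsum β γ := by
  intro f hf
  obtain ⟨h1, h2⟩ := h (fun i => f (e i)) fun i => hf (e i)
  have h3 : ∀ m : γ → β, ∏ i, f (e i) (m (e i)) = ∏ i, f i (m i) :=
    fun m => e.prod_comp fun i => f i (m i)
  refine ⟨?_, ?_⟩
  · simp_rw [← h3]
    exact h1.comp_injective (i := fun m : γ → β => m ∘ e) e.surjective.injective_comp_right
  · rw [← e.prod_comp, h2, ← (Equiv.arrowCongr e (Equiv.refl β)).symm.tsum_eq]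
    exact tsum_congr h3

theorem ProdTsum.option {α β : Type*} [Fintype α] (h : ProdTsum β α) :
    ProdTsum β (Option α) := by
  intro f hf
  obtain ⟨h1, h2⟩ := h (fun i => f (some i)) fun i => hf (some i)
  set F : β × (α → β) → ℂ := fun p => f none p.1 * ∏ i, f (some i) (p.2 i) with hF
  have h3 : Summable fun p => ‖F p‖ :=
    Summable.mul_norm (f := fun b => f none b) (g := fun m : α → β => ∏ i, f (some i) (m i))
      (hf none) h1
  let e : (Option α → β) ≃ β × (α → β) := Equiv.piOptionEquivProd
  have h4 : ∀ m : Option α → β, ∏ i, f i (m i) = F (e m) := fun m =>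
    Fintype.prod_option fun i => f i (m i)
  have h5 : ∏ i, ∑' b, f i b = ∑' p, F p := by
    rw [Fintype.prod_option, h2, tsum_mul_tsum_of_summable_norm (hf none) h1]
  simp_rw [h4]
  clear_value F e
  exact ⟨e.summable_iff.2 h3, h5.trans (e.tsum_eq F).symm⟩

theorem prodTsum.{u, v} (β : Type u) (κ : Type v) [Fintype κ] :
    ProdTsum β κ := by
  refine Fintype.induction_empty_option (P := fun (κ : Type v) (_ : Fintype κ) => ProdTsum β κ)
    ?_ ?_ ?_ κ
  · intro α γ _ e ih
    let _ : Fintype α := Fintype.ofEquiv γ e.symm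
    exact ProdTsum.congr e ih
  · exact fun f _ => ⟨Summable.of_finite, by simp⟩
  · exact fun α _ ih => ProdTsum.option ih

/-- Orthogonality of characters: translation by the class of `a` permutes the quotient and
multiplies the sum by `χ a`. -/
theorem sum_quotient_out_eq {M : Type*} [AddCommGroup M] (S : Submodule ℤ M) [Fintype (M ⧸ S)]
    (χ : M → ℂ) (hadd : ∀ a b, χ (a + b) = χ a * χ b) (hS : ∀ a ∈ S, χ a = 1) :
    ((∀ a, χ a = 1) → ∑ h : M ⧸ S, χ h.out = Fintype.card (M ⧸ S)) ∧
      ((¬ ∀ a, χ a = 1) → ∑ h : M ⧸ S, χ h.out = 0) := by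
  refine ⟨fun h => by simp [h], fun h => ?_⟩
  push Not at h
  obtain ⟨a, ha⟩ := h
  have hcongr : ∀ b c : M, (Submodule.Quotient.mk b : M ⧸ S) = Submodule.Quotient.mk c →
      χ b = χ c := by
    intro b c hbc
    rw [← add_sub_cancel c b, hadd, hS _ ((Submodule.Quotient.eq S).1 hbc), mul_one]
  have h1 : ∑ h : M ⧸ S, χ h.out = (∑ h : M ⧸ S, χ h.out) * χ a := by
    rw [Finset.sum_mul, ← Equiv.sum_comp (Equiv.addRight (Submodule.Quotient.mk a : M ⧸ S))]
    refine Finset.sum_congr rfl fun h _ => ?_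
    rw [← hadd]
    apply hcongr
    have hout : ∀ h : M ⧸ S, (Submodule.Quotient.mk h.out : M ⧸ S) = h := fun h =>
      Quotient.out_eq' h
    rw [Submodule.Quotient.mk_add, hout, hout]
    rfl
  have h2 : (∑ h : M ⧸ S, χ h.out) * (χ a - 1) = 0 := by linear_combination -h1
  exact (mul_eq_zero.1 h2).resolve_right (sub_ne_zero.2 ha)

/-! ### Pairings -/

section Pairings

variable {L : Type*} [AddCommGroup L]

@[simp] theorem pairing_tmul (u : Module.Dual ℝ (ℝ ⊗[ℤ] L)) (a : ℂ) (l : L) :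
    pairing u (a ⊗ₜ[ℤ] l) = a * (u ((1 : ℝ) ⊗ₜ[ℤ] l) : ℂ) := by
  rw [pairing, LinearMap.liftBaseChange_tmul]
  rfl

@[simp] theorem latticePairing_tmul (u : Module.Dual ℤ L) (a : ℂ) (l : L) :
    latticePairing u (a ⊗ₜ[ℤ] l) = a * (u l : ℂ) := by
  simp [latticePairing]

/-- The imaginary part `L_ℂ → L_ℝ`. -/
def imPart : ℂ ⊗[ℤ] L →+ ℝ ⊗[ℤ] L :=
  (LinearMap.rTensor L Complex.imAddGroupHom.toIntLinearMap).toAddMonoidHom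

theorem imPart_tmul (a : ℂ) (l : L) : imPart (a ⊗ₜ[ℤ] l) = a.im ⊗ₜ[ℤ] l := rfl

theorem dual_tmul (u : Module.Dual ℝ (ℝ ⊗[ℤ] L)) (a : ℝ) (l : L) :
    u (a ⊗ₜ[ℤ] l) = a * u ((1 : ℝ) ⊗ₜ[ℤ] l) := by
  rw [← smul_eq_mul, ← map_smul, TensorProduct.smul_tmul', smul_eq_mul, mul_one]

/-- This turns the strip conditions on `w` into the position of the real vector `Im w` relative to
the walls of the cones. -/
theorem pairing_im (u : Module.Dual ℝ (ℝ ⊗[ℤ] L)) (w : ℂ ⊗[ℤ] L) :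
    (pairing u w).im = u (imPart w) := by
  induction w using TensorProduct.induction_on with
  | zero => simp
  | tmul a l =>
    rw [pairing_tmul, imPart_tmul, dual_tmul u a.im]
    simp
  | add x y hx hy => rw [map_add, map_add, map_add, Complex.add_im, hx, hy]

/-- The real-linear extension of `u ∈ L^*`. -/
def realExtension (u : Module.Dual ℤ L) : Module.Dual ℝ (ℝ ⊗[ℤ] L) :=
  LinearMap.liftBaseChange ℝ (Algebra.linearMap ℤ ℝ ∘ₗ u)

@[simp] theorem realExtension_tmul (u : Module.Dual ℤ L) (l : L) :
    realExtension u ((1 : ℝ) ⊗ₜ[ℤ] l) = u l := by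
  simp [realExtension]

end Pairings

namespace MultiFan

variable {ι L : Type*} [AddCommGroup L]

namespace GeneratingVectors

variable {Δ : MultiFan ι L} (V : Δ.GeneratingVectors)

/-! ### Cones and their spans -/

/-- The generators supplied with a cone may differ from the `v_i`, but they span the same rays. -/
theorem cone_eq_hull {J : Finset ι} (hJ : J ∈ Δ.simplices) :
    Δ.cone J = PointedCone.hull ℝ ((fun i => (1 : ℝ) ⊗ₜ[ℤ] V.vec i) '' (J : Set ι)) := by
  obtain ⟨g, -, hc⟩ := Δ.cone_simplicial J hJ
  have h1 : ∀ i ∈ J, PointedCone.hull ℝ {(1 : ℝ) ⊗ₜ[ℤ] V.vec i} =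
      PointedCone.hull ℝ {(1 : ℝ) ⊗ₜ[ℤ] g i} := by
    intro i hi
    rw [V.hull_vec, hc {i} (by simpa using hi)]
    simp
  rw [hc J subset_rfl]
  apply le_antisymm
  · refine Submodule.span_le.2 ?_
    rintro _ ⟨i, hi, rfl⟩
    have h2 : (1 : ℝ) ⊗ₜ[ℤ] g i ∈ PointedCone.hull ℝ {(1 : ℝ) ⊗ₜ[ℤ] V.vec i} := by
      rw [h1 i hi]
      exact Submodule.subset_span rfl
    exact Submodule.span_mono (Set.singleton_subset_iff.2 (Set.mem_image_of_mem _ hi)) h2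
  · refine Submodule.span_le.2 ?_
    rintro _ ⟨i, hi, rfl⟩
    have h2 : (1 : ℝ) ⊗ₜ[ℤ] V.vec i ∈ PointedCone.hull ℝ {(1 : ℝ) ⊗ₜ[ℤ] g i} := by
      rw [← h1 i hi]
      exact Submodule.subset_span rfl
    exact Submodule.span_mono (Set.singleton_subset_iff.2 (Set.mem_image_of_mem _ hi)) h2

theorem span_cone {J : Finset ι} (hJ : J ∈ Δ.simplices) :
    Submodule.span ℝ (Δ.cone J : Set (ℝ ⊗[ℤ] L)) =
      Submodule.span ℝ ((fun i => (1 : ℝ) ⊗ₜ[ℤ] V.vec i) '' (J : Set ι)) := by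
  rw [V.cone_eq_hull hJ]
  exact Submodule.span_span_of_tower _ _ _

theorem span_cone_mono (V : Δ.GeneratingVectors) {J K : Finset ι} (hK : K ∈ Δ.simplices) (hJK : J ⊆ K) :
    Submodule.span ℝ (Δ.cone J : Set (ℝ ⊗[ℤ] L)) ≤
      Submodule.span ℝ (Δ.cone K : Set (ℝ ⊗[ℤ] L)) := by
  rw [V.span_cone hK, V.span_cone (Δ.down_closed K hK J hJK)]
  exact Submodule.span_mono (Set.image_mono (Finset.coe_subset.2 hJK))

/-- For `J ⊆ K` the span of `C(K)` contains that of `C(J)`, so a projected wall pulls back to the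
wall itself. One vector generic for `Δ` thus serves every `Δ_J`. -/
theorem isGeneric_mkQ (V : Δ.GeneratingVectors) {J : Finset ι} {y : ℝ ⊗[ℤ] L}
    (hy : ∀ K ∈ Δ.simplices, K.card < Module.finrank ℤ L →
      y ∉ Submodule.span ℝ (Δ.cone K : Set (ℝ ⊗[ℤ] L))) :
    Δ.IsGeneric J (Submodule.mkQ (Submodule.span ℝ (Δ.cone J : Set (ℝ ⊗[ℤ] L))) y) := by
  intro K hK hJK hcard hmem
  refine hy K hK hcard ?_
  rw [projCone, PointedCone.coe_map, Submodule.span_image, Submodule.mem_map] at hmem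
  obtain ⟨c, hc, hcy⟩ := hmem
  have h1 : c - y ∈ Submodule.span ℝ (Δ.cone J : Set (ℝ ⊗[ℤ] L)) :=
    (Submodule.Quotient.eq _).1 hcy
  have h2 := Submodule.sub_mem _ hc (V.span_cone_mono hK hJK h1)
  rwa [sub_sub_cancel] at h2

variable [Module.Free ℤ L]

theorem span_cone_ne_top (V : Δ.GeneratingVectors) {K : Finset ι} (hK : K ∈ Δ.simplices)
    (hcard : K.card < Module.finrank ℤ L) :
    Submodule.span ℝ (Δ.cone K : Set (ℝ ⊗[ℤ] L)) ≠ ⊤ := by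
  classical
  intro h
  rw [V.span_cone hK, ← Finset.coe_image] at h
  have h1 := finrank_span_finset_le_card (R := ℝ) (K.image fun i => (1 : ℝ) ⊗ₜ[ℤ] V.vec i)
  rw [Set.finrank, h, finrank_top, Module.finrank_baseChange] at h1
  exact absurd (h1.trans Finset.card_image_le) hcard.not_ge

variable [Module.Finite ℤ L]

theorem card_le_finrank (V : Δ.GeneratingVectors) {J : Finset ι} (hJ : J ∈ Δ.simplices) :
    J.card ≤ Module.finrank ℤ L := by
  have h1 : LinearIndependent ℝ (fun i : J => (1 : ℝ) ⊗ₜ[ℤ] V.vec i) := V.linearIndepOn J hJ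
  have h2 := h1.fintype_card_le_finrank
  rwa [Module.finrank_baseChange, Fintype.card_coe] at h2

@[simp] theorem basis_apply (I : Δ.topSimplices) (i : I.1) :
    V.basis I i = (1 : ℝ) ⊗ₜ[ℤ] V.vec i :=
  Module.Basis.mk_apply _ _ _

theorem dualVec_vec (I : Δ.topSimplices) (i j : I.1) [Decidable (i = j)] :
    V.dualVec I i ((1 : ℝ) ⊗ₜ[ℤ] V.vec j) = if i = j then 1 else 0 := by
  classical
  rw [← V.basis_apply I j, dualVec, Module.Basis.coord_apply, Module.Basis.repr_self,
    Finsupp.single_apply]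
  exact if_congr eq_comm rfl rfl

theorem sum_dualVec_smul (I : Δ.topSimplices) (x : ℝ ⊗[ℤ] L) :
    ∑ i, V.dualVec I i x • ((1 : ℝ) ⊗ₜ[ℤ] V.vec i) = x := by
  have := (V.basis I).sum_repr x
  simp_rw [basis_apply] at this
  exact this

theorem dualVec_nonneg_of_mem_cone (I : Δ.topSimplices) (i : I.1) {c : ℝ ⊗[ℤ] L}
    (hc : c ∈ Δ.cone I) : 0 ≤ V.dualVec I i c := by
  classical
  rw [V.cone_eq_hull (Finset.mem_filter.1 I.2).1] at hc
  induction hc using Submodule.span_induction with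
  | mem x hx =>
    obtain ⟨j, hj, rfl⟩ := hx
    change 0 ≤ V.dualVec I i ((1 : ℝ) ⊗ₜ[ℤ] V.vec ((⟨j, hj⟩ : I.1) : ι))
    rw [V.dualVec_vec]
    split_ifs <;> norm_num
  | zero => simp
  | add x y _ _ hx hy => rw [map_add]; exact add_nonneg hx hy
  | smul a x _ hx =>
    have : a • x = (a : ℝ) • x := rfl
    rw [this, map_smul]
    exact mul_nonneg a.2 hx

theorem dualVec_eq_zero_of_mem_span (I : Δ.topSimplices) (i : I.1) {J : Finset ι} (hJI : J ⊆ I.1)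
    (hi : (i : ι) ∉ J) {c : ℝ ⊗[ℤ] L}
    (hc : c ∈ Submodule.span ℝ (Δ.cone J : Set (ℝ ⊗[ℤ] L))) : V.dualVec I i c = 0 := by
  classical
  rw [V.span_cone (Δ.down_closed _ (Finset.mem_filter.1 I.2).1 J hJI)] at hc
  suffices h : Submodule.span ℝ ((fun i => (1 : ℝ) ⊗ₜ[ℤ] V.vec i) '' (J : Set ι)) ≤
      LinearMap.ker (V.dualVec I i) from LinearMap.mem_ker.1 (h hc)
  refine Submodule.span_le.2 ?_
  rintro _ ⟨j, hj, rfl⟩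
  change V.dualVec I i ((1 : ℝ) ⊗ₜ[ℤ] V.vec ((⟨j, hJI hj⟩ : I.1) : ι)) = 0
  rw [V.dualVec_vec, if_neg]
  rintro rfl
  exact hi hj

/-- Modulo the span of `C(J)` the coordinates indexed by `J` are arbitrary, so only the others are
tested. Setting those in `J` to zero gives a preimage in `C(I)`. -/
theorem mkQ_mem_projCone_iff (I : Δ.topSimplices) {J : Finset ι} (hJI : J ⊆ I.1)
    (x : ℝ ⊗[ℤ] L) :
    (Submodule.mkQ (Submodule.span ℝ (Δ.cone J : Set (ℝ ⊗[ℤ] L))) x : Δ.ProjSpace J) ∈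
      Δ.projCone J I.1 ↔ ∀ i : I.1, (i : ι) ∉ J → 0 ≤ V.dualVec I i x := by
  classical
  have hI := (Finset.mem_filter.1 I.2).1
  rw [projCone, PointedCone.mem_map]
  constructor
  · rintro ⟨c, hc, hcx⟩ i hi
    have h1 : c - x ∈ Submodule.span ℝ (Δ.cone J : Set (ℝ ⊗[ℤ] L)) :=
      (Submodule.Quotient.eq _).1 hcx
    have h2 := V.dualVec_eq_zero_of_mem_span I i hJI hi h1
    rw [map_sub, sub_eq_zero] at h2
    rw [← h2]
    exact V.dualVec_nonneg_of_mem_cone I i hc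
  · intro h
    refine ⟨∑ i : I.1, (if (i : ι) ∈ J then 0 else V.dualVec I i x) •
      ((1 : ℝ) ⊗ₜ[ℤ] V.vec i), ?_, ?_⟩
    · rw [V.cone_eq_hull hI]
      refine Submodule.sum_mem _ fun i _ => ?_
      have h0 : 0 ≤ (if (i : ι) ∈ J then 0 else V.dualVec I i x) := by
        split_ifs with hi
        exacts [le_rfl, h i hi]
      exact Submodule.smul_mem _ (⟨_, h0⟩ : {c : ℝ // 0 ≤ c})
        (Submodule.subset_span ⟨i, i.2, rfl⟩)
    · refine (Submodule.Quotient.eq _).2 ?_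
      suffices h1 : (∑ i : I.1, (if (i : ι) ∈ J then 0 else V.dualVec I i x) •
          ((1 : ℝ) ⊗ₜ[ℤ] V.vec i)) - ∑ i, V.dualVec I i x • ((1 : ℝ) ⊗ₜ[ℤ] V.vec i) ∈
          Submodule.span ℝ (Δ.cone J : Set (ℝ ⊗[ℤ] L)) by rwa [V.sum_dualVec_smul I x] at h1
      rw [← Finset.sum_sub_distrib]
      refine Submodule.sum_mem _ fun i _ => ?_
      rw [← sub_smul]
      split_ifs with hi
      · rw [V.span_cone (Δ.down_closed _ hI J hJI)]
        exact Submodule.smul_mem _ _ (Submodule.subset_span ⟨i, hi, rfl⟩)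
      · simp

/-! ### Degrees -/

/-- The hypothesis only keeps `x` off the walls of top-dimensional cones, while genericity also
concerns simplices contained in no top simplex. A small move in a direction outside all the proper
spans repairs this without changing any sign. -/
theorem exists_perturbation {x : ℝ ⊗[ℤ] L}
    (hx : ∀ (I : Δ.topSimplices) (i : I.1), V.dualVec I i x ≠ 0) :
    ∃ y : ℝ ⊗[ℤ] L, (∀ K ∈ Δ.simplices, K.card < Module.finrank ℤ L →
        y ∉ Submodule.span ℝ (Δ.cone K : Set (ℝ ⊗[ℤ] L))) ∧
      ∀ (I : Δ.topSimplices) (i : I.1), 0 ≤ V.dualVec I i y ↔ 0 < V.dualVec I i x := by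
  classical
  set S : Finset (Finset ι) := Δ.simplices.filter fun K => K.card < Module.finrank ℤ L
  set s : Finset (Submodule ℝ (ℝ ⊗[ℤ] L)) :=
    S.image fun K => Submodule.span ℝ (Δ.cone K : Set (ℝ ⊗[ℤ] L))
  have htop : ⊤ ∉ s := by
    intro h
    obtain ⟨K, hK, hKtop⟩ := Finset.mem_image.1 h
    exact V.span_cone_ne_top (Finset.mem_filter.1 hK).1 (Finset.mem_filter.1 hK).2 hKtop
  obtain ⟨d, hd⟩ := (Set.ne_univ_iff_exists_notMem _).1
    (Subspace.biUnion_ne_univ_of_top_notMem htop)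
  have hd' : ∀ K ∈ S, d ∉ Submodule.span ℝ (Δ.cone K : Set (ℝ ⊗[ℤ] L)) := by
    intro K hK hdK
    exact hd (Set.mem_biUnion (Finset.mem_image_of_mem _ hK) hdK)
  have h1 : ∀ᶠ ε : ℝ in 𝓝[>] 0, ∀ K ∈ S,
      x + ε • d ∉ Submodule.span ℝ (Δ.cone K : Set (ℝ ⊗[ℤ] L)) := by
    refine (Finset.eventually_all S).2 fun K hK => ?_
    -- A subspace not containing `d` meets the line `x + ε d` at most once, so at most one positive
    -- `ε` is excluded.
    by_cases h : ∃ ε₀ : ℝ, 0 < ε₀ ∧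
        x + ε₀ • d ∈ Submodule.span ℝ (Δ.cone K : Set (ℝ ⊗[ℤ] L))
    · obtain ⟨ε₀, hε₀, hmem⟩ := h
      filter_upwards [Ioo_mem_nhdsGT hε₀] with ε hε hmem'
      have h2 := Submodule.sub_mem _ hmem hmem'
      rw [add_sub_add_left_eq_sub, ← sub_smul] at h2
      exact hd' K hK ((Submodule.smul_mem_iff _ (sub_pos.2 hε.2).ne').1 h2)
    · push Not at h
      filter_upwards [self_mem_nhdsWithin] with ε hε
      exact h ε hε
  have h2 : ∀ᶠ ε : ℝ in 𝓝[>] 0, ∀ (I : Δ.topSimplices) (i : I.1),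
      0 ≤ V.dualVec I i (x + ε • d) ↔ 0 < V.dualVec I i x := by
    refine eventually_nhdsWithin_of_eventually_nhds ?_
    refine eventually_all.2 fun I => eventually_all.2 fun i => ?_
    have hcont : Tendsto (fun ε : ℝ => V.dualVec I i (x + ε • d)) (𝓝 0) (𝓝 (V.dualVec I i x)) := by
      have : Continuous fun ε : ℝ => V.dualVec I i x + ε * V.dualVec I i d := by fun_prop
      simpa using this.tendsto 0
    rcases lt_or_gt_of_ne (hx I i) with h | h
    · filter_upwards [hcont.eventually (gt_mem_nhds h)] with ε hε
      exact ⟨fun h' => absurd hε h'.not_gt, fun h' => absurd h h'.not_gt⟩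
    · filter_upwards [hcont.eventually (lt_mem_nhds h)] with ε hε
      exact ⟨fun _ => h, fun _ => hε.le⟩
  obtain ⟨ε, hε1, hε2⟩ := (h1.and h2).exists
  exact ⟨x + ε • d, fun K hK hcard => hε1 K (Finset.mem_filter.2 ⟨hK, hcard⟩), hε2⟩

open Classical in
/-- The degree of `Δ_J` can be computed at any vector off the walls of the top-dimensional
cones. -/
theorem degree_eq_sum (hΔ : Δ.IsComplete) {J : Finset ι} (hJ : J ∈ Δ.simplices) {x : ℝ ⊗[ℤ] L}
    (hx : ∀ (I : Δ.topSimplices) (i : I.1), V.dualVec I i x ≠ 0) :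
    Δ.degree J = ∑ I : Δ.topSimplices,
      if J ⊆ I.1 ∧ ∀ i : I.1, (i : ι) ∉ J → 0 < V.dualVec I i x then Δ.w I else 0 := by
  obtain ⟨y, hy1, hy2⟩ := V.exists_perturbation hx
  have h := hΔ J hJ
  rw [degree, dif_pos h, ← h.choose_spec _ (V.isGeneric_mkQ hy1), localDegree, Finset.sum_filter,
    ← Finset.sum_coe_sort]
  refine Finset.sum_congr rfl fun I _ => if_congr (and_congr_right fun hJI => ?_) rfl rfl
  rw [V.mkQ_mem_projCone_iff I hJI]
  exact forall_congr' fun i => imp_congr_right fun _ => hy2 I i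

open Classical in
-- Expand each product over subsets `J ⊆ I` and exchange the sums. For fixed `J`, the weights of the
-- `I ⊇ J` that survive add up to `deg(Δ_J)`.
theorem characterCoeff_eq_sum (hΔ : Δ.IsComplete) {x : ℝ ⊗[ℤ] L}
    (hx : ∀ (I : Δ.topSimplices) (i : I.1), V.dualVec I i x ≠ 0) (u : Module.Dual ℤ L) (τ σ : ℂ) :
    Δ.characterCoeff V u τ σ = ∑ I : Δ.topSimplices, (Δ.w I : ℂ) * ∏ i : I.1,
      ellipticCoeff (0 < V.dualVec I i x) (expTwoPiI σ) (expTwoPiI τ) (u (V.vec i)) := by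
  set b : ι → ℂ := fun i => 1 / (1 - expTwoPiI σ * expTwoPiI τ ^ (u (V.vec i))) with hb
  -- The indicator is extended by `1` to vertices outside `I`, so that products can run over finite
  -- sets of vertices.
  set δ : Δ.topSimplices → ι → ℂ := fun I i =>
    if ∀ h : i ∈ I.1, 0 < V.dualVec I ⟨i, h⟩ x then 1 else 0 with hδ
  have h1 : Δ.characterCoeff V u τ σ =
      ∑ J ∈ Δ.simplices, (-1) ^ J.card * (Δ.degree J : ℂ) * ∏ j ∈ J, b j := by
    rw [characterCoeff, ← Finset.sum_fiberwise_of_maps_to (s := Δ.simplices)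
      (t := Finset.range (Module.finrank ℤ L + 1)) (g := Finset.card)
      (fun J hJ => Finset.mem_range.2 (Nat.lt_succ_of_le (V.card_le_finrank hJ)))]
    refine Finset.sum_congr rfl fun k _ => Finset.sum_congr rfl fun J hJ => ?_
    rw [(Finset.mem_filter.1 hJ).2]
  have h2 : ∀ I : Δ.topSimplices, ∏ i : I.1,
      ellipticCoeff (0 < V.dualVec I i x) (expTwoPiI σ) (expTwoPiI τ) (u (V.vec i)) =
      ∑ J ∈ Δ.simplices, if J ⊆ I.1 then
        ((-1) ^ J.card * ∏ i ∈ I.1 \ J, δ I i) * ∏ j ∈ J, b j else 0 := by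
    intro I
    have h3 : ∏ i : I.1,
        ellipticCoeff (0 < V.dualVec I i x) (expTwoPiI σ) (expTwoPiI τ) (u (V.vec i)) =
        ∏ i ∈ I.1, (δ I i - b i) := by
      rw [← Finset.prod_coe_sort I.1 fun i => δ I i - b i]
      refine Finset.prod_congr rfl fun i _ => ?_
      rw [ellipticCoeff, hδ, hb]
      simp
    rw [h3, Finset.prod_sub, ← Finset.sum_filter]
    refine Finset.sum_congr ?_ fun _ _ => rfl
    ext J
    rw [Finset.mem_powerset, Finset.mem_filter]
    exact ⟨fun h => ⟨Δ.down_closed _ (Finset.mem_filter.1 I.2).1 J h, h⟩, fun h => h.2⟩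
  have h4 : ∀ (I : Δ.topSimplices) (J : Finset ι), ∏ i ∈ I.1 \ J, δ I i =
      if ∀ i : I.1, (i : ι) ∉ J → 0 < V.dualVec I i x then 1 else 0 := by
    intro I J
    rw [hδ, Finset.prod_boole]
    refine if_congr ?_ rfl rfl
    constructor
    · intro h i hi
      exact h i (Finset.mem_sdiff.2 ⟨i.2, hi⟩) i.2
    · intro h i hi hiI
      exact h ⟨i, hiI⟩ (Finset.mem_sdiff.1 hi).2
  simp_rw [h1, h2, Finset.mul_sum]
  rw [Finset.sum_comm]
  refine Finset.sum_congr rfl fun J hJ => ?_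
  rw [V.degree_eq_sum hΔ hJ hx, Int.cast_sum, Finset.mul_sum, Finset.sum_mul]
  refine Finset.sum_congr rfl fun I _ => ?_
  rw [h4]
  by_cases hJI : J ⊆ I.1
  · by_cases hpos : ∀ i : I.1, (i : ι) ∉ J → 0 < V.dualVec I i x
    · rw [if_pos ⟨hJI, hpos⟩, if_pos hJI, if_pos hpos]
      ring
    · rw [if_neg (fun h => hpos h.2), if_pos hJI, if_neg hpos]
      simp
  · rw [if_neg (fun h => hJI h.1), if_neg hJI]
    simp

/-! ### The contribution of a top-dimensional simplex -/

/-- The map `u ↦ (⟨u, v_i⟩)_{i ∈ I}`. -/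
def evalVec (I : Δ.topSimplices) (u : Module.Dual ℤ L) : I.1 → ℤ := fun i => u (V.vec i)

theorem sum_evalVec_mul_dualVec (I : Δ.topSimplices) (u : Module.Dual ℤ L) (l : L) :
    ∑ i, (V.evalVec I u i : ℝ) * V.dualVec I i ((1 : ℝ) ⊗ₜ[ℤ] l) = u l := by
  have h := congrArg (realExtension u) (V.sum_dualVec_smul I ((1 : ℝ) ⊗ₜ[ℤ] l))
  rw [map_sum, realExtension_tmul] at h
  rw [← h]
  refine Finset.sum_congr rfl fun i _ => ?_
  rw [map_smul, realExtension_tmul, smul_eq_mul, mul_comm]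
  rfl

theorem evalVec_injective (I : Δ.topSimplices) : Function.Injective (V.evalVec I) := by
  intro u u' h
  ext l
  have h1 := V.sum_evalVec_mul_dualVec I u l
  rw [h, V.sum_evalVec_mul_dualVec I u' l] at h1
  exact_mod_cast h1.symm

theorem latticePairing_eq_sum (I : Δ.topSimplices) (u : Module.Dual ℤ L) (w : ℂ ⊗[ℤ] L) :
    latticePairing u w = ∑ i, (V.evalVec I u i : ℂ) * pairing (V.dualVec I i) w := by
  induction w using TensorProduct.induction_on with
  | zero => simp
  | tmul a l =>
    have h := congrArg (fun r : ℝ => (r : ℂ)) (V.sum_evalVec_mul_dualVec I u l)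
    simp only [Complex.ofReal_sum, Complex.ofReal_mul, Complex.ofReal_intCast] at h
    rw [latticePairing_tmul, ← h, Finset.mul_sum]
    refine Finset.sum_congr rfl fun i _ => ?_
    rw [pairing_tmul]
    ring
  | add x y hx hy =>
    rw [map_add, hx, hy, ← Finset.sum_add_distrib]
    refine Finset.sum_congr rfl fun i _ => ?_
    rw [map_add, mul_add]

/-- The character `l ↦ e(-∑ m_i ⟨u_i^I, l⟩)` of `L`. -/
def latticeChar (I : Δ.topSimplices) (m : I.1 → ℤ) (l : L) : ℂ :=
  expTwoPiI (-((∑ i, (m i : ℝ) * V.dualVec I i ((1 : ℝ) ⊗ₜ[ℤ] l) : ℝ) : ℂ))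

theorem latticeChar_eq_one_iff (I : Δ.topSimplices) (m : I.1 → ℤ) (l : L) :
    V.latticeChar I m l = 1 ↔
      ∃ k : ℤ, ∑ i, (m i : ℝ) * V.dualVec I i ((1 : ℝ) ⊗ₜ[ℤ] l) = k := by
  rw [latticeChar, expTwoPiI_eq_one_iff]
  constructor
  · rintro ⟨k, hk⟩
    refine ⟨-k, ?_⟩
    rw [neg_eq_iff_eq_neg] at hk
    exact_mod_cast hk
  · rintro ⟨k, hk⟩
    exact ⟨-k, by rw [hk]; push_cast; rfl⟩

theorem latticeChar_add (I : Δ.topSimplices) (m : I.1 → ℤ) (a b : L) :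
    V.latticeChar I m (a + b) = V.latticeChar I m a * V.latticeChar I m b := by
  rw [latticeChar, latticeChar, latticeChar, ← expTwoPiI_add, ← neg_add, ← Complex.ofReal_add,
    ← Finset.sum_add_distrib]
  simp_rw [TensorProduct.tmul_add, map_add, mul_add]

theorem sum_mul_dualVec_vec (I : Δ.topSimplices) (m : I.1 → ℤ) (j : I.1) :
    ∑ i, (m i : ℝ) * V.dualVec I i ((1 : ℝ) ⊗ₜ[ℤ] V.vec j) = m j := by
  classical
  simp_rw [V.dualVec_vec]
  simp

theorem latticeChar_of_mem_sublattice (I : Δ.topSimplices) (m : I.1 → ℤ) {a : L}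
    (ha : a ∈ V.sublattice I) : V.latticeChar I m a = 1 := by
  rw [sublattice] at ha
  rw [latticeChar_eq_one_iff]
  induction ha using Submodule.span_induction with
  | mem x hx =>
    obtain ⟨j, hj, rfl⟩ := hx
    exact ⟨m ⟨j, hj⟩, V.sum_mul_dualVec_vec I m ⟨j, hj⟩⟩
  | zero => exact ⟨0, by simp⟩
  | add x y _ _ hx hy =>
    obtain ⟨k, hk⟩ := hx
    obtain ⟨k', hk'⟩ := hy
    refine ⟨k + k', ?_⟩
    simp_rw [TensorProduct.tmul_add, map_add, mul_add, Finset.sum_add_distrib, hk, hk']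
    push_cast
    rfl
  | smul a x _ hx =>
    obtain ⟨k, hk⟩ := hx
    refine ⟨a * k, ?_⟩
    simp_rw [TensorProduct.tmul_smul, map_zsmul, zsmul_eq_mul, mul_left_comm _ (a : ℝ),
      ← Finset.mul_sum, hk]
    push_cast
    rfl

/-- The character is trivial exactly when `∑ m_i u_i^I` takes integral values on `L`. It is then an
element of `L^*`, whose value at `v_j` is `m_j`. -/
theorem forall_latticeChar_eq_one_iff (I : Δ.topSimplices) (m : I.1 → ℤ) :
    (∀ l, V.latticeChar I m l = 1) ↔ m ∈ Set.range (V.evalVec I) := by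
  simp_rw [latticeChar_eq_one_iff]
  constructor
  · intro h
    choose k hk using h
    refine ⟨(AddMonoidHom.mk' k fun a b => ?_).toIntLinearMap, funext fun j => ?_⟩
    · have : ((k (a + b) : ℤ) : ℝ) = ((k a + k b : ℤ) : ℝ) := by
        rw [← hk, Int.cast_add, ← hk a, ← hk b, ← Finset.sum_add_distrib]
        simp_rw [TensorProduct.tmul_add, map_add, mul_add]
      exact_mod_cast this
    · have := hk (V.vec j)
      rw [V.sum_mul_dualVec_vec] at this
      exact_mod_cast this.symm
  · rintro ⟨u, rfl⟩ l
    exact ⟨u l, V.sum_evalVec_mul_dualVec I u l⟩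

theorem dualVec_imPart_ne_zero {w : ℂ ⊗[ℤ] L}
    (hw : ∀ (I : Δ.topSimplices) (i : I.1), 0 < |(pairing (V.dualVec I i) w).im|)
    (I : Δ.topSimplices) (i : I.1) : V.dualVec I i (imPart w) ≠ 0 := by
  rw [← pairing_im]
  exact abs_pos.1 (hw I i)

open Classical in
/-- The contribution of a top-dimensional simplex to the elliptic genus. -/
theorem sum_prod_ellipticPhi (I : Δ.topSimplices) {w : ℂ ⊗[ℤ] L} {τ σ : ℂ}
    (hw : ∀ i : I.1, 0 < |(pairing (V.dualVec I i) w).im| ∧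
      |(pairing (V.dualVec I i) w).im| < τ.im)
    (hσ : ∀ m : ℤ, expTwoPiI σ * expTwoPiI τ ^ m ≠ 1) :
    (Summable fun u : Module.Dual ℤ L => expTwoPiI (-(latticePairing u w)) *
      ∏ i : I.1, ellipticCoeff (0 < V.dualVec I i (imPart w)) (expTwoPiI σ) (expTwoPiI τ)
        (u (V.vec i))) ∧
    (∑ h : V.H I, ∏ i : I.1,
      ellipticPhi (pairing (V.dualVec I i) (-w - (1 : ℂ) ⊗ₜ[ℤ] h.out)) τ σ) =
      (Fintype.card (V.H I) : ℂ) * jacobiPhi σ τ ^ Module.finrank ℤ L *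
      ∑' u : Module.Dual ℤ L, expTwoPiI (-(latticePairing u w)) *
        ∏ i : I.1, ellipticCoeff (0 < V.dualVec I i (imPart w)) (expTwoPiI σ) (expTwoPiI τ)
          (u (V.vec i)) := by
  set c : I.1 → ℤ → ℂ := fun i m =>
    ellipticCoeff (0 < V.dualVec I i (imPart w)) (expTwoPiI σ) (expTwoPiI τ) m with hc
  set A : (I.1 → ℤ) → ℂ := fun m =>
    ∏ i, (expTwoPiI (-pairing (V.dualVec I i) w) ^ m i * c i (m i)) with hA
  have hz : ∀ (l : L) (i : I.1), pairing (V.dualVec I i) (-w - (1 : ℂ) ⊗ₜ[ℤ] l) =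
      -pairing (V.dualVec I i) w + -((V.dualVec I i ((1 : ℝ) ⊗ₜ[ℤ] l) : ℝ) : ℂ) := by
    intro l i
    rw [map_sub, map_neg, pairing_tmul, one_mul, sub_eq_add_neg]
  have him : ∀ (l : L) (i : I.1), (pairing (V.dualVec I i) (-w - (1 : ℂ) ⊗ₜ[ℤ] l)).im =
      -V.dualVec I i (imPart w) := by
    intro l i
    rw [hz, ← pairing_im]
    simp
  have hexp : ∀ (l : L) (i : I.1),
      (Summable fun m : ℤ =>
        ‖expTwoPiI (pairing (V.dualVec I i) (-w - (1 : ℂ) ⊗ₜ[ℤ] l)) ^ m * c i m‖) ∧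
      ellipticPhi (pairing (V.dualVec I i) (-w - (1 : ℂ) ⊗ₜ[ℤ] l)) τ σ = jacobiPhi σ τ *
        ∑' m : ℤ, expTwoPiI (pairing (V.dualVec I i) (-w - (1 : ℂ) ⊗ₜ[ℤ] l)) ^ m * c i m := by
    intro l i
    have h := hw i
    rw [pairing_im] at h
    have h1 := ellipticPhi_expansion (z := pairing (V.dualVec I i) (-w - (1 : ℂ) ⊗ₜ[ℤ] l))
      (τ := τ) (σ := σ) (by rw [him, abs_neg]; exact h.1) (by rw [him, abs_neg]; exact h.2) hσ
    -- The argument involves `-w`, so the sign is reversed. The shift by a lattice vector is real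
    -- and does not affect it.
    have h2 : (pairing (V.dualVec I i) (-w - (1 : ℂ) ⊗ₜ[ℤ] l)).im < 0 ↔
        0 < V.dualVec I i (imPart w) := by rw [him, neg_lt_zero]
    simpa only [hc, ellipticCoeff, h2] using h1
  have hterm : ∀ (l : L) (m : I.1 → ℤ),
      ∏ i, (expTwoPiI (pairing (V.dualVec I i) (-w - (1 : ℂ) ⊗ₜ[ℤ] l)) ^ m i * c i (m i)) =
        A m * V.latticeChar I m l := by
    intro l m
    rw [latticeChar, Complex.ofReal_sum, ← Finset.sum_neg_distrib, expTwoPiI_sum, hA,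
      ← Finset.prod_mul_distrib]
    refine Finset.prod_congr rfl fun i _ => ?_
    rw [hz, expTwoPiI_add, mul_zpow, ← expTwoPiI_zsmul _ (-((V.dualVec I i _ : ℝ) : ℂ))]
    push_cast
    rw [mul_neg]
    ring
  have hprod : ∀ l : L, (Summable fun m : I.1 → ℤ => ‖A m * V.latticeChar I m l‖) ∧
      ∏ i : I.1, ellipticPhi (pairing (V.dualVec I i) (-w - (1 : ℂ) ⊗ₜ[ℤ] l)) τ σ =
        jacobiPhi σ τ ^ Module.finrank ℤ L * ∑' m : I.1 → ℤ, A m * V.latticeChar I m l := by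
    intro l
    have h := prodTsum ℤ I.1 (fun (i : I.1) (m : ℤ) =>
      expTwoPiI (pairing (V.dualVec I i) (-w - (1 : ℂ) ⊗ₜ[ℤ] l)) ^ m * c i m)
      fun i => (hexp l i).1
    simp_rw [hterm] at h
    refine ⟨h.1, ?_⟩
    rw [Finset.prod_congr rfl fun i _ => (hexp l i).2, Finset.prod_mul_distrib,
      Finset.prod_const, Finset.card_univ, Fintype.card_coe, (Finset.mem_filter.1 I.2).2, h.2]
  have hAsum : Summable A := by
    refine ((hprod 0).1.congr fun m => ?_).of_norm
    rw [V.latticeChar_of_mem_sublattice I m (Submodule.zero_mem _), mul_one]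
  have hAeval : ∀ u : Module.Dual ℤ L, A (V.evalVec I u) = expTwoPiI (-(latticePairing u w)) *
      ∏ i : I.1, ellipticCoeff (0 < V.dualVec I i (imPart w)) (expTwoPiI σ) (expTwoPiI τ)
        (u (V.vec i)) := by
    intro u
    rw [V.latticePairing_eq_sum I, ← Finset.sum_neg_distrib, expTwoPiI_sum, hA,
      ← Finset.prod_mul_distrib]
    refine Finset.prod_congr rfl fun i _ => ?_
    rw [← expTwoPiI_zsmul, mul_neg]
    rfl
  -- Summing over `H_I` retains only the exponents that come from `L^*`.
  have hchar : ∀ m : I.1 → ℤ, ∑ h : V.H I, A m * V.latticeChar I m h.out =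
      (Fintype.card (V.H I) : ℂ) * (if m ∈ Set.range (V.evalVec I) then A m else 0) := by
    intro m
    have h := sum_quotient_out_eq (V.sublattice I) (V.latticeChar I m) (V.latticeChar_add I m)
      fun a ha => V.latticeChar_of_mem_sublattice I m ha
    rw [V.forall_latticeChar_eq_one_iff] at h
    rw [← Finset.mul_sum]
    split_ifs with hm
    · rw [h.1 hm, mul_comm]
    · rw [h.2 hm, mul_zero, mul_zero]
  simp_rw [← hAeval]
  refine ⟨hAsum.comp_injective (V.evalVec_injective I), ?_⟩
  rw [Finset.sum_congr rfl fun h _ => (hprod h.out).2, ← Finset.mul_sum,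
    ← Summable.tsum_finsetSum fun (h : V.H I) _ => (hprod h.out).1.of_norm]
  simp_rw [hchar]
  rw [tsum_mul_left, mul_left_comm, mul_assoc]
  congr 2
  rw [← (V.evalVec_injective I).tsum_eq]
  · exact tsum_congr fun u => if_pos ⟨u, rfl⟩
  · intro m hm
    by_contra h
    exact hm (if_neg h)

end GeneratingVectors

end MultiFan

end

/-! ### Summation over the top-dimensional simplices -/

theorem mainTheorem3 {ι L : Type*} [AddCommGroup L] [Module.Free ℤ L] [Module.Finite ℤ L]
    (Δ : MultiFan ι L) (hΔ : Δ.IsComplete) (V : Δ.GeneratingVectors)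
    (w : ℂ ⊗[ℤ] L) (τ σ : ℂ) (hτ : 0 < τ.im)
    (hw : ∀ (I : Δ.topSimplices) (i : I.1),
      0 < |(pairing (V.dualVec I i) w).im| ∧ |(pairing (V.dualVec I i) w).im| < τ.im)
    (hσ : ∀ m : ℤ, expTwoPiI σ * expTwoPiI τ ^ m ≠ 1) :
    Summable (fun u : Module.Dual ℤ L =>
        expTwoPiI (-(latticePairing u w)) * Δ.characterCoeff V u τ σ) ∧
      Δ.ellipticGenus V w τ σ =
        (∑' u : Module.Dual ℤ L,
          expTwoPiI (-(latticePairing u w)) * Δ.characterCoeff V u τ σ) *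
          jacobiPhi σ τ ^ (Module.finrank ℤ L) := by
  classical
  -- `Im w` lies off every wall of a top cone, so it can serve as the test vector for all the
  -- degrees at once.
  have hx := V.dualVec_imPart_ne_zero fun I i => (hw I i).1
  have hI := fun I : Δ.topSimplices => V.sum_prod_ellipticPhi I (hw I) hσ
  have hcoeff : ∀ u : Module.Dual ℤ L,
      expTwoPiI (-(latticePairing u w)) * Δ.characterCoeff V u τ σ =
      ∑ I : Δ.topSimplices, (Δ.w I : ℂ) * (expTwoPiI (-(latticePairing u w)) *
        ∏ i : I.1, ellipticCoeff (0 < V.dualVec I i (imPart w)) (expTwoPiI σ) (expTwoPiI τ)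
          (u (V.vec i))) := by
    intro u
    rw [V.characterCoeff_eq_sum hΔ hx, Finset.mul_sum]
    exact Finset.sum_congr rfl fun I _ => mul_left_comm _ _ _
  simp_rw [hcoeff]
  refine ⟨summable_sum fun I _ => (hI I).1.mul_left _, ?_⟩
  rw [Summable.tsum_finsetSum fun I _ => (hI I).1.mul_left _, MultiFan.ellipticGenus,
    Finset.sum_mul]
  refine Finset.sum_congr rfl fun I _ => ?_
  have hcard : (Fintype.card (V.H I) : ℂ) ≠ 0 := Nat.cast_ne_zero.2 Fintype.card_ne_zero
  rw [(hI I).2, tsum_mul_left]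
  field_simp
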